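/- **Setting.** Fix $n\in\mathbb N$ and let $\mathfrak g=\mathfrak{su}(n)$ (trace-free skew-Hermitian complex $n\times n$ matrices) with the inner product $\langle X,Y\rangle=\operatorname{Tr}X^*Y$ and the induced norm. Fix a radial $C^\infty$ function $\rho_0\ge 0$ on $\mathbb R^2$ with $\operatorname{supp}\rho_0\subset\{1-\tfrac17\le|\xi|\le 2\}$, $\rho_0(\xi)=1$ for $1\le|\xi|\le 2-\tfrac27$, and $\rho_0(\xi)+\rho_0(\xi/2)=1$ for $1\le|\xi|\le 4-\tfrac47$. Put $\rho_j=\rho_0(2^{-j}\cdot)$ for $j\ge 0$ and $\rho_{-1}(\xi)=\sum_{j\le -1}\rho_0(2^{-j}\xi)$ for $\xi\ne0$, $\rho_{-1}(0)=1$. For a tempered distribution $u$ on $\mathbb R^2$ let $\Delta_ju=\check\rho_j*u$ for $j\ge-1$, where $\check\rho_j(z)=(2\pi)^{-2}\int e^{i\langle z,\xi\rangle}\rho_j(\xi)\,d\xi$, and $\mathbf S_ju=\sum_{i=-1}^{j-1}\Delta_iu$. Let $\mathfrak C$ be the set of $C^\infty$ curves $\mathfrak c=(\mathfrak c_1,\mathfrak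 c_2):\mathbb R\to\mathbb R^2$ with $\operatorname{supp}\dot{\mathfrak c}\subset[0,1]$ and $\mathfrak c_1>0$. For $\mathfrak c\in\mathfrak C$ and $h\in L^\infty(\mathbb R)$ let $\mathcal E_{\mathfrak c}h\in L^2(\mathbb R^2)$ be determined by $$\langle H,\mathcal E_{\mathfrak c}h\rangle_{L^2(\mathbb R^2)}=\int_{\mathbb R}\int_0^{\mathfrak c_1(t)}H(x_1,\mathfrak c_2(t))\,h(t)\,\dot{\mathfrak c}_2(t)\,dx_1\,dt\qquad(H\in L^2(\mathbb R^2)),$$ and let $\mathfrak C_{\mathrm{Rot}}$ be the set of $\mathfrak c\in\mathfrak C$ with $\sup_{(s,t)\in\mathbb R^2}\|\mathcal E_{\mathfrak c}\mathbf 1_{[s,t]}\|_{L^\infty}<\infty$. Let $W$ be a $\mathfrak g$-valued Gaussian white noise on $\mathbb R^2$ over a probability space $(\Omega,\mathbb P)$: a linear map $W:L^2(\mathbb R^2)\to L^2(\mathbb P,\mathfrak g)$ such that the variables $\langle W(f),X\rangle$ ($f\in L^2(\mathbb R^2)$, $X\in\mathfrak g$) are jointly Gaussian and centred, with $\mathbb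 E[\langle W(f),X\rangle\langle W(g),Y\rangle]=\langle f,g\rangle_{L^2}\langle X,Y\rangle$, and whose restriction to $\mathcal S(\mathbb R^2)$ is taken in a version for which every sample is a $\mathfrak g$-valued tempered distribution. Let $W^{(j)}=\mathbf S_jW\in C^\infty(\mathbb R^2,\mathfrak g)$, let $A^{(j)}=A^{(j)}_1dx_1+A^{(j)}_2dx_2$ with $A^{(j)}_1=0$ and $A^{(j)}_2(x)=\int_0^{x_1}W^{(j)}(\xi,x_2)\,d\xi$, and put $$X^{(j)}_t=\int_{\mathfrak c|[0,t]}A^{(j)}=\int_0^t\sum_{k=1}^2A^{(j)}_k(\mathfrak c(\tau))\,\dot{\mathfrak c}_k(\tau)\,d\tau,\qquad X^{(j)}_{s,t}=X^{(j)}_t-X^{(j)}_s .$$ **Proposition 8.5.** Let $\mathfrak c\in\mathfrak C_{\mathrm{Rot}}$ and $q\in[1,\infty)$. There is a constant $C=C(\mathfrak c,q)>0$ (for the fixed $n$ and $\rho_0$; it does not depend on $(\Omega,\mathbb P)$, $W$, $j$, $s$, $t$ or $\mathfrak s$) such that for all integers $j\ge-1$, all $0\le s<t\le1$ and all $\mathfrak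 s\in(0,1/2]$, the variable $X^{(j)}_{s,t}$ belongs to $L^q(\mathbb P,\mathfrak g)$ and $$\big\|X^{(j)}_{s,t}\big\|_{L^q(\mathbb P,\mathfrak g)}\le C\,(t-s)^{1/2-\mathfrak s}.$$ -/

import Mathlib

open MeasureTheory ProbabilityTheory
open scoped ENNReal FourierTransform SchwartzMap Matrix

namespace YangMillsPlane

/-- The Euclidean plane; the coordinates `x₁, x₂` are `x 0, x 1`. -/
abbrev Plane : Type := EuclideanSpace ℝ (Fin 2)

/-! ### The Lie algebra `𝔤 = 𝔰𝔲(n)` with the Hilbert–Schmidt inner product -/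

/-- The real vector space of trace-free skew-Hermitian complex `n × n` matrices. -/
def suSubmodule (n : ℕ) : Submodule ℝ (Matrix (Fin n) (Fin n) ℂ) where
  carrier := {X | Xᴴ = -X ∧ X.trace = 0}
  add_mem' := by
    rintro X Y ⟨hX, hX'⟩ ⟨hY, hY'⟩
    refine ⟨?_, ?_⟩
    · rw [Matrix.conjTranspose_add, hX, hY, neg_add]
    · rw [Matrix.trace_add, hX', hY', add_zero]
  zero_mem' := by simp
  smul_mem' := by
    rintro a X ⟨hX, hX'⟩
    refine ⟨?_, ?_⟩
    · rw [Matrix.conjTranspose_smul, hX, star_trivial, smul_neg]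
    · rw [Matrix.trace_smul, hX', smul_zero]

/-- `𝔰𝔲(n)`, as a type which carries the Hilbert–Schmidt norm. -/
def su (n : ℕ) : Type := suSubmodule n

/-- The matrix underlying an element of `𝔰𝔲(n)`. -/
def su.toMatrix {n : ℕ} (X : su n) : Matrix (Fin n) (Fin n) ℂ := X.1

noncomputable instance (n : ℕ) : AddCommGroup (su n) :=
  inferInstanceAs (AddCommGroup (suSubmodule n))

noncomputable instance (n : ℕ) : Module ℝ (su n) :=
  inferInstanceAs (Module ℝ (suSubmodule n))

instance (n : ℕ) : FiniteDimensional ℝ (su n) :=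
  inferInstanceAs (FiniteDimensional ℝ (suSubmodule n))

theorem trace_conjTranspose_mul_self_re {n : ℕ} (X : Matrix (Fin n) (Fin n) ℂ) :
    (Xᴴ * X).trace.re = ∑ i, ∑ j, Complex.normSq (X j i) := by
  simp [Matrix.trace, Matrix.mul_apply, Complex.normSq_apply]

/-- `⟨X, Y⟩ = Tr (X* Y)`; the trace is real on `𝔰𝔲(n)`, so that taking its real part only
changes its type. -/
@[reducible] noncomputable def suCore (n : ℕ) : InnerProductSpace.Core ℝ (su n) where
  inner X Y := (X.toMatrixᴴ * Y.toMatrix).trace.re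
  conj_inner_symm X Y := by
    have h : (X.toMatrixᴴ * Y.toMatrix).trace = star (Y.toMatrixᴴ * X.toMatrix).trace := by
      rw [← Matrix.trace_conjTranspose, Matrix.conjTranspose_mul,
        Matrix.conjTranspose_conjTranspose]
    change (Y.toMatrixᴴ * X.toMatrix).trace.re = (X.toMatrixᴴ * Y.toMatrix).trace.re
    rw [h]; simp
  re_inner_nonneg X := by
    change 0 ≤ (X.toMatrixᴴ * X.toMatrix).trace.re
    rw [trace_conjTranspose_mul_self_re]
    exact Finset.sum_nonneg fun i _ => Finset.sum_nonneg fun j _ => Complex.normSq_nonneg _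
  add_left X Y Z := by
    change ((X.toMatrix + Y.toMatrix)ᴴ * Z.toMatrix).trace.re = _
    rw [Matrix.conjTranspose_add, Matrix.add_mul, Matrix.trace_add, Complex.add_re]
  smul_left X Y r := by
    change ((r • X.toMatrix)ᴴ * Y.toMatrix).trace.re = r * (X.toMatrixᴴ * Y.toMatrix).trace.re
    rw [Matrix.conjTranspose_smul, Matrix.smul_mul, Matrix.trace_smul]
    simp
  definite X h := by
    change (X.toMatrixᴴ * X.toMatrix).trace.re = 0 at h
    rw [trace_conjTranspose_mul_self_re, Finset.sum_eq_zero_iff_of_nonneg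
      (fun i _ => Finset.sum_nonneg fun j _ => Complex.normSq_nonneg _)] at h
    apply Subtype.ext
    ext j i
    have h1 := h i (Finset.mem_univ _)
    rw [Finset.sum_eq_zero_iff_of_nonneg (fun j _ => Complex.normSq_nonneg _)] at h1
    exact Complex.normSq_eq_zero.1 (h1 j (Finset.mem_univ _))

noncomputable instance (n : ℕ) : NormedAddCommGroup (su n) :=
  (suCore n).toNormedAddCommGroup

noncomputable instance (n : ℕ) : InnerProductSpace ℝ (su n) :=
  InnerProductSpace.ofCore (suCore n).toCore

instance (n : ℕ) : CompleteSpace (su n) := FiniteDimensional.complete ℝ (su n)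

/-! ### Littlewood–Paley operators -/

/-- A radial bump function `ρ = ρ₀` on the plane that generates a dyadic partition of unity. -/
structure LPBump where
  toFun : Plane → ℝ
  smooth : ContDiff ℝ (⊤ : ℕ∞) toFun
  radial : ∀ x y : Plane, ‖x‖ = ‖y‖ → toFun x = toFun y
  nonneg : ∀ x, 0 ≤ toFun x
  supp : tsupport toFun ⊆ {x | 1 - 1 / 7 ≤ ‖x‖ ∧ ‖x‖ ≤ 2}
  eq_one : ∀ x, 1 ≤ ‖x‖ → ‖x‖ ≤ 2 - 2 / 7 → toFun x = 1
  add_eq_one : ∀ x, 1 ≤ ‖x‖ → ‖x‖ ≤ 4 - 4 / 7 → toFun x + toFun ((1 / 2 : ℝ) • x) = 1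

/-- `χ₀(ξ) = ∑_{j ≤ -1} ρ₀(2^{-j} ξ)` for `ξ ≠ 0` (with `j = -(k + 1)`), and `χ₀(0) = 1`. -/
noncomputable def LPBump.chi (ρ : LPBump) (ξ : Plane) : ℝ :=
  open Classical in if ξ = 0 then 1 else ∑' k : ℕ, ρ.toFun ((2 : ℝ) ^ (k + 1) • ξ)

/-- `ρ_{-1} = χ₀` and `ρ_j = ρ₀(2^{-j} ·)` for `j ≥ 0`; only indices `j ≥ -1` are used. -/
noncomputable def LPBump.mult (ρ : LPBump) (j : ℤ) (ξ : Plane) : ℝ :=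
  if j < 0 then ρ.chi ξ else ρ.toFun ((2 : ℝ) ^ (-j) • ξ)

theorem LPBump.eq_zero_of_lt (ρ : LPBump) {x : Plane} (hx : ‖x‖ < 1 - 1 / 7) :
    ρ.toFun x = 0 := by
  by_contra h
  exact absurd (ρ.supp (subset_tsupport _ h)).1 (not_le.2 hx)

theorem LPBump.eq_zero_of_gt (ρ : LPBump) {x : Plane} (hx : 2 < ‖x‖) : ρ.toFun x = 0 := by
  by_contra h
  exact absurd (ρ.supp (subset_tsupport _ h)).2 (not_le.2 hx)

theorem LPBump.eq_zero_of_ge (ρ : LPBump) {x : Plane} (hx : 2 ≤ ‖x‖) : ρ.toFun x = 0 := by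
  have h1 := ρ.add_eq_one x (by linarith) 
  by_cases h : ‖x‖ ≤ 4 - 4 / 7
  · have h2 := ρ.eq_one ((1 / 2 : ℝ) • x) (by rw [norm_smul]; norm_num; linarith)
      (by rw [norm_smul]; norm_num; linarith)
    linarith [h1 h]
  · exact ρ.eq_zero_of_gt (by linarith)

theorem LPBump.chi_eq_one (ρ : LPBump) {ξ : Plane} (hξ : ‖ξ‖ < 1 / 2) : ρ.chi ξ = 1 := by
  by_cases h0 : ξ = 0
  · simp [LPBump.chi, h0]
  rw [LPBump.chi, if_neg h0]
  have hr : 0 < ‖ξ‖ := norm_pos_iff.2 h0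
  obtain ⟨n, hn1, hn2⟩ := exists_nat_pow_near (x := 1 / ‖ξ‖) (y := (2 : ℝ))
    (by rw [le_div_iff₀ hr]; linarith) (by norm_num)
  rw [le_div_iff₀ hr] at hn1
  rw [div_lt_iff₀ hr] at hn2
  obtain ⟨m, rfl⟩ : ∃ m, n = m + 1 := by
    refine Nat.exists_eq_succ_of_ne_zero ?_
    rintro rfl
    norm_num at hn2
    linarith
  have hnorm : ∀ k : ℕ, ‖(2 : ℝ) ^ (k + 1) • ξ‖ = 2 ^ (k + 1) * ‖ξ‖ := fun k => by
    rw [norm_smul, norm_pow, Real.norm_ofNat]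
  rw [tsum_eq_sum (s := {m, m + 1})]
  · rw [Finset.sum_pair (by simp), add_comm]
    have h1 := ρ.add_eq_one ((2 : ℝ) ^ (m + 1 + 1) • ξ) (by rw [hnorm]; exact hn2.le)
      (by rw [hnorm, pow_succ]; nlinarith)
    rw [smul_smul, pow_succ (2 : ℝ) (m + 1)] at h1
    rw [pow_succ (2 : ℝ) (m + 1)]
    convert h1 using 4
    ring
  · intro k hk
    simp only [Finset.mem_insert, Finset.mem_singleton, not_or] at hk
    rcases lt_or_gt_of_ne hk.1 with h | h
    · apply ρ.eq_zero_of_lt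
      rw [hnorm]
      have : (2 : ℝ) ^ (k + 1) ≤ 2 ^ m := pow_le_pow_right₀ (by norm_num) h
      rw [pow_succ] at hn1
      nlinarith
    · apply ρ.eq_zero_of_gt
      rw [hnorm]
      have : (2 : ℝ) ^ (m + 1 + 1 + 1) ≤ 2 ^ (k + 1) :=
        pow_le_pow_right₀ (by norm_num) (by omega)
      rw [pow_succ] at this
      nlinarith

theorem LPBump.chi_eq_zero (ρ : LPBump) {ξ : Plane} (hξ : 1 ≤ ‖ξ‖) : ρ.chi ξ = 0 := by
  have h0 : ξ ≠ 0 := by rintro rfl; simp at hξ; linarith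
  rw [LPBump.chi, if_neg h0]
  have : ∀ k : ℕ, ρ.toFun ((2 : ℝ) ^ (k + 1) • ξ) = 0 := fun k => by
    apply ρ.eq_zero_of_ge
    rw [norm_smul, norm_pow, Real.norm_ofNat, pow_succ]
    nlinarith [one_le_pow₀ (M₀ := ℝ) (a := 2) (n := k) (by norm_num)]
  simp [this]

theorem LPBump.chi_contDiff (ρ : LPBump) : ContDiff ℝ (⊤ : ℕ∞) ρ.chi := by
  rw [contDiff_iff_contDiffAt]
  intro ξ
  rcases lt_or_ge ‖ξ‖ (1 / 2) with h | h
  · refine (contDiffAt_const (c := (1 : ℝ))).congr_of_eventuallyEq ?_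
    filter_upwards [(isOpen_lt continuous_norm continuous_const).mem_nhds h] with x hx
    exact ρ.chi_eq_one hx
  · have hs : ContDiff ℝ (⊤ : ℕ∞) fun x : Plane =>
        ∑ k ∈ Finset.range 2, ρ.toFun ((2 : ℝ) ^ (k + 1) • x) :=
      ContDiff.sum fun k _ => ρ.smooth.comp (contDiff_const_smul _)
    refine hs.contDiffAt.congr_of_eventuallyEq ?_
    have h4 : (1 / 4 : ℝ) < ‖ξ‖ := by linarith
    filter_upwards [(isOpen_lt continuous_const continuous_norm).mem_nhds h4] with x hx
    replace hx : (1 / 4 : ℝ) < ‖x‖ := hx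
    have h0 : x ≠ 0 := by rintro rfl; simp at hx; linarith
    rw [LPBump.chi, if_neg h0, tsum_eq_sum]
    intro k hk
    apply ρ.eq_zero_of_ge
    rw [norm_smul, norm_pow, Real.norm_ofNat]
    have h3 : 2 ≤ k := by simp at hk; omega
    have h5 : (2 : ℝ) ^ 3 ≤ 2 ^ (k + 1) := pow_le_pow_right₀ (by norm_num) (by omega)
    norm_num at h5
    nlinarith

theorem LPBump.mult_contDiff (ρ : LPBump) (j : ℤ) : ContDiff ℝ (⊤ : ℕ∞) (ρ.mult j) := by
  unfold LPBump.mult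
  split_ifs
  · exact ρ.chi_contDiff
  · exact ρ.smooth.comp (contDiff_const_smul _)

theorem LPBump.mult_hasCompactSupport (ρ : LPBump) (j : ℤ) : HasCompactSupport (ρ.mult j) := by
  unfold LPBump.mult
  split_ifs
  · refine HasCompactSupport.intro (isCompact_closedBall (0 : Plane) 1) fun x hx => ?_
    exact ρ.chi_eq_zero (by simpa using le_of_lt (by simpa using hx : 1 < ‖x‖))
  · have h : HasCompactSupport ρ.toFun :=
      HasCompactSupport.intro (isCompact_closedBall (0 : Plane) 2) fun x hx =>
        ρ.eq_zero_of_gt (by simpa using hx)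
    exact h.comp_smul (by positivity)

/-- The Schwartz function `ξ ↦ ρ_j(2π ξ)`. -/
noncomputable def LPBump.multSchwartz (ρ : LPBump) (j : ℤ) : 𝓢(Plane, ℂ) :=
  HasCompactSupport.toSchwartzMap (f := fun ξ => (ρ.mult j ((2 * Real.pi) • ξ) : ℂ))
    (((ρ.mult_hasCompactSupport j).comp_smul (c := 2 * Real.pi) (by positivity)).comp_left
      (g := fun r : ℝ => (r : ℂ)) Complex.ofReal_zero)
    (Complex.ofRealCLM.contDiff.comp
      ((ρ.mult_contDiff j).comp (contDiff_const_smul (2 * Real.pi))))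

/-- The inverse Fourier transform `ρ̌_j(z) = (2π)⁻² ∫ e^{i⟨z, ξ⟩} ρ_j(ξ) dξ`. The transform of
Mathlib has the phase `e^{2πi⟨z, ξ⟩}` and no prefactor, so the substitution of `2πξ` for `ξ` gives
the stated normalization. The function `ρ_j` is even, so `ρ̌_j` is real-valued. -/
noncomputable def LPBump.kernel (ρ : LPBump) (j : ℤ) : 𝓢(Plane, ℝ) :=
  SchwartzMap.postcompCLM Complex.reCLM (𝓕⁻ (ρ.multSchwartz j))

/-- The Schwartz function `y ↦ φ(x - y)`. -/
noncomputable def reflect (φ : 𝓢(Plane, ℝ)) (x : Plane) : 𝓢(Plane, ℝ) :=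
  SchwartzMap.compSubConstCLM ℝ x
    (SchwartzMap.compCLMOfContinuousLinearEquiv ℝ (ContinuousLinearEquiv.neg ℝ) φ)

theorem reflect_apply (φ : 𝓢(Plane, ℝ)) (x y : Plane) : reflect φ x y = φ (x - y) := by
  simp [reflect]

section LittlewoodPaley

variable {V : Type*} [NormedAddCommGroup V] [NormedSpace ℝ V]

/-- `Δ_j u = ρ̌_j * u` for a `V`-valued tempered distribution `u`: the smooth function
`x ↦ u(ρ̌_j(x - ·))`. -/
noncomputable def LPBump.delta (ρ : LPBump) (j : ℤ) (u : 𝓢(Plane, ℝ) →L[ℝ] V) (x : Plane) : V :=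
  u (reflect (ρ.kernel j) x)

/-- `S_j u = ∑_{i=-1}^{j-1} Δ_i u`. -/
noncomputable def LPBump.lowPass (ρ : LPBump) (j : ℤ) (u : 𝓢(Plane, ℝ) →L[ℝ] V) (x : Plane) : V :=
  ∑ i ∈ Finset.Ico (-1) j, ρ.delta i u x

/-! ### Axial gauge and line integrals -/

/-- The gauge field `A = A₁ dx₁ + A₂ dx₂` in axial gauge with field strength `F₁₂ = F`:
`A₁ = 0` and `A₂(x) = ∫_0^{x₁} F(ξ, x₂) dξ`. -/
noncomputable def axialGauge (F : Plane → V) (x : Plane) : Fin 2 → V :=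
  ![0, ∫ ξ in (0 : ℝ)..x 0, F !₂[ξ, x 1]]

/-- The line integral of `A = A₁ dx₁ + A₂ dx₂` along the curve `c` restricted to `[0, t]`. -/
noncomputable def lineIntegral (c : ℝ → Plane) (A : Plane → Fin 2 → V) (t : ℝ) : V :=
  ∫ τ in (0 : ℝ)..t, ∑ k, deriv c τ k • A (c τ) k

end LittlewoodPaley

/-! ### Curves, the operator `𝓔_c`, and the rotation number -/

/-- Smooth curves `c : ℝ → ℝ²` in the right half plane with `supp ċ ⊆ [0, 1]`. -/
structure IsCurve (c : ℝ → Plane) : Prop where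
  smooth : ContDiff ℝ (⊤ : ℕ∞) c
  supp : tsupport (deriv c) ⊆ Set.Icc 0 1
  pos : ∀ t, 0 < c t 0

/-- `𝓔̂_c(H, h) = ∫_ℝ ∫_0^{c₁(t)} H(x₁, c₂(t)) h(t) ċ₂(t) dx₁ dt`. -/
noncomputable def pairing (c : ℝ → Plane) (H : Plane → ℝ) (h : ℝ → ℝ) : ℝ :=
  ∫ t, ∫ x₁ in (0 : ℝ)..c t 0, H !₂[x₁, c t 1] * h t * deriv c t 1

/-- `𝓔_c h ∈ L²(ℝ²)`: the vector that represents the functional `H ↦ 𝓔̂_c(H, h)` on `L²(ℝ²)`.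
(It is unique, and it exists for every smooth curve `c` as above and every bounded measurable `h`;
in other cases it may not exist, and then the value is `0`.) -/
noncomputable def curveOp (c : ℝ → Plane) (h : ℝ → ℝ) : Lp ℝ 2 (volume : Measure Plane) :=
  open Classical in
  if hE : ∃ u : Lp ℝ 2 (volume : Measure Plane),
      ∀ H : Lp ℝ 2 (volume : Measure Plane), inner ℝ H u = pairing c H h
  then hE.choose else 0

/-- `Rot(c) = sup_{s, t} ‖𝓔_c 1_{[s, t]}‖_{L^∞}`. -/
noncomputable def rot (c : ℝ → Plane) : ℝ≥0∞ :=
  ⨆ (s : ℝ) (t : ℝ), eLpNorm (curveOp c ((Set.Icc s t).indicator 1)) ∞ volume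

/-- The class `ℭ_Rot` of curves with finite rotation number. -/
def curvesRot : Set (ℝ → Plane) := {c | IsCurve c ∧ rot c < ∞}

/-! ### White noise -/

/-- An `𝔰𝔲(n)`-valued (Gaussian) white noise on the plane over the probability space `(Ω, P)`: a
linear map `W : L²(ℝ²) → L²(P, 𝔰𝔲(n))` such that the variables `⟨W(f), X⟩` are jointly Gaussian and
centred, with covariance `E ⟨W(f), X⟩⟨W(g), Y⟩ = ⟨f, g⟩⟨X, Y⟩`, that is,
`E W(f)_k W(g)_l = δ_{kl} ⟨f, g⟩` in an orthonormal basis of `𝔰𝔲(n)`; together with a version of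
its restriction to Schwartz functions every sample of which is a tempered distribution. -/
structure WhiteNoise (n : ℕ) {Ω : Type*} [MeasurableSpace Ω] (P : Measure Ω) where
  toL2 : Lp ℝ 2 (volume : Measure Plane) →ₗ[ℝ] Lp (su n) 2 P
  gaussian : IsGaussianProcess
    (fun (p : Lp ℝ 2 (volume : Measure Plane) × su n) (ω : Ω) => inner ℝ (toL2 p.1 ω) p.2) P
  mean : ∀ f X, ∫ ω, inner ℝ (toL2 f ω) X ∂P = 0
  cov : ∀ f g X Y, ∫ ω, inner ℝ (toL2 f ω) X * inner ℝ (toL2 g ω) Y ∂P = inner ℝ f g * inner ℝ X Y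
  sample : Ω → 𝓢(Plane, ℝ) →L[ℝ] su n
  sample_ae : ∀ φ : 𝓢(Plane, ℝ), ∀ᵐ ω ∂P, sample ω φ = toL2 (φ.toLp 2 volume) ω

section Approximation

variable {n : ℕ} {Ω : Type*} [MeasurableSpace Ω] {P : Measure Ω}

/-- The smooth approximation `W^{(j)} = S_j W`. -/
noncomputable def WhiteNoise.approx (W : WhiteNoise n P) (ρ : LPBump) (j : ℤ) (ω : Ω) :
    Plane → su n :=
  ρ.lowPass j (W.sample ω)

/-- `X^{(j)}_c(t) = ∫_{c|[0, t]} A^{(j)}`, where `A^{(j)}` is the gauge field in axial gauge with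
field strength `W^{(j)}`. -/
noncomputable def WhiteNoise.process (W : WhiteNoise n P) (ρ : LPBump) (c : ℝ → Plane) (j : ℤ)
    (t : ℝ) (ω : Ω) : su n :=
  lineIntegral c (axialGauge (W.approx ρ j ω)) t

/-- `X^{(j)}_{s,t} = X^{(j)}_t - X^{(j)}_s`. -/
noncomputable def WhiteNoise.increment (W : WhiteNoise n P) (ρ : LPBump) (c : ℝ → Plane) (j : ℤ)
    (s t : ℝ) (ω : Ω) : su n :=
  W.process ρ c j t ω - W.process ρ c j s ω

end Approximation

end YangMillsPlane

/-!
The increment `X_{s,t}` is an integral of the smoothed noise `W^{(j)} = W(K_j(x - ·))` over the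
surface swept out below the curve, so formally `X_{s,t} = W(Φ)`, where `Φ` is the convolution of
`u = 𝓔_c 1_{[s, t]}` with the (reflected) low-pass kernel `K_j`. Then `X_{s,t}` is Gaussian, its
`L^q` norm is at most a constant times `‖Φ‖₂`, and `‖Φ‖₂ ≤ ‖K_j‖₁ ‖u‖₂` by Young's inequality. The
kernels `K_j` are dilates of a single Schwartz function, so `‖K_j‖₁` is bounded in `j`. Finally
`‖u‖₂² ≤ ‖u‖_∞ ‖u‖₁`, where `‖u‖_∞ ≤ Rot(c) < ∞` and `‖u‖₁ = O(t - s)`. This gives the rate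
`(t - s)^{1/2}`, which is at most `(t - s)^{1/2 - σ}` since `t - s ≤ 1`.

Two points need an argument.

* `𝓔_c 1_{[s, t]}` has to exist as an element of `L²`. The number of times the curve crosses a
  horizontal line is in general unbounded, but by an integration by parts
  `∫ g(c₂(τ)) ċ₂(τ)² dτ ≤ ‖c₂''‖₁ ‖g‖₁` for `g ≥ 0` (`lintegral_comp_mul_deriv_sq_le`). Hence
  `H ↦ H(x₁, c₂(τ)) ċ₂(τ)` is a bounded map between `L²` spaces (`IsCurve.memLp_sweep`), and the
  vector exists by the Riesz representation theorem (`IsCurve.inner_curveOp`).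
* `X_{s,t} = W(Φ)` exchanges a sample of the noise with an integral. For each sample the increment
  is a limit of Riemann sums, each of which is almost surely `W` of a Riemann sum `Φ_N`, and
  `Φ_N → Φ` in `L²`; the bound on the `L^q` norm passes to the limit by Fatou's lemma
  (`WhiteNoise.memLp_increment`). The pathwise limit uses that `x ↦ K(x - ·)` is continuous into the
  Schwartz space (`continuous_reflect`).
-/

namespace YangMillsPlane

/-! ### Compositions weighted by the square of the derivative -/

/-- If `G' = g`, then `g(f) f'² = (G ∘ f)' f'` integrates to `-∫ G(f) f''`, and `|G| ≤ ∫ g`. -/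
theorem integral_comp_mul_deriv_sq_le {f : ℝ → ℝ} (hf : ContDiff ℝ 2 f)
    (hs : HasCompactSupport (deriv f)) {g : ℝ → ℝ} (hg : Continuous g) (hg0 : ∀ x, 0 ≤ g x)
    (hgi : Integrable g) :
    ∫ t, g (f t) * deriv f t ^ 2 ≤ (∫ t, |deriv (deriv f) t|) * ∫ y, g y := by
  have hf' : ContDiff ℝ 1 (deriv f) := by
    have : ContDiff ℝ (1 + 1) f := by norm_num; exact hf
    exact ((contDiff_succ_iff_deriv).1 this).2.2
  have hf'' : Continuous (deriv (deriv f)) := hf'.continuous_deriv le_rfl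
  have hfc : Continuous f := hf.continuous
  set G : ℝ → ℝ := fun y => ∫ x in (0 : ℝ)..y, g x with hG
  have hGd : ∀ y, HasDerivAt G (g y) y := fun y =>
    (hg.integral_hasStrictDerivAt 0 y).hasDerivAt
  have hGc : Continuous G := continuous_iff_continuousAt.2 fun y => (hGd y).continuousAt
  have hGb : ∀ y, |G y| ≤ ∫ x, g x := fun y => by
    refine (intervalIntegral.norm_integral_le_integral_norm_uIoc (f := g) (a := 0) (b := y)
      (μ := volume)).trans ?_
    refine (setIntegral_le_integral hgi.norm
      (Filter.Eventually.of_forall fun x => norm_nonneg _)).trans (le_of_eq ?_)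
    simp [abs_of_nonneg (hg0 _)]
  have key := integral_mul_deriv_eq_deriv_mul_of_integrable (u := G ∘ f) (v := deriv f)
    (u' := fun t => g (f t) * deriv f t) (v' := deriv (deriv f))
    (fun t _ => (hGd (f t)).comp t ((hf.differentiable (by norm_num)) t).hasDerivAt)
    (fun t _ => (hf'.differentiable (by norm_num) t).hasDerivAt)
    (((hGc.comp hfc).mul hf'').integrable_of_hasCompactSupport hs.deriv.mul_left)
    ((((hg.comp hfc).mul hf'.continuous).mul hf'.continuous).integrable_of_hasCompactSupport
      hs.mul_left)
    (((hGc.comp hfc).mul hf'.continuous).integrable_of_hasCompactSupport hs.mul_left)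
  have h1 : ∫ t, g (f t) * deriv f t ^ 2 = -∫ t, G (f t) * deriv (deriv f) t := by
    have : (∫ t, g (f t) * deriv f t ^ 2) = ∫ t, g (f t) * deriv f t * deriv f t :=
      integral_congr_ae (Filter.Eventually.of_forall fun t => by ring)
    rw [this]
    simp only [Function.comp_apply] at key
    linarith
  rw [h1, mul_comm, ← integral_const_mul]
  have h2 : ‖∫ t, G (f t) * deriv (deriv f) t‖ ≤ ∫ t, (∫ y, g y) * |deriv (deriv f) t| := by
    refine norm_integral_le_of_norm_le
      ((hf''.abs.integrable_of_hasCompactSupport hs.deriv.norm).const_mul _)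
      (Filter.Eventually.of_forall fun t => ?_)
    rw [Real.norm_eq_abs, abs_mul]
    exact mul_le_mul_of_nonneg_right (hGb _) (abs_nonneg _)
  exact (neg_le_abs _).trans h2

/-- The push-forward of `|f'|² dt` under `f` has bounded density. The density at `y` is
`∑ |f'(t)|` over the solutions of `f t = y`, but the bound is obtained from an integration by
parts and does not need that formula. -/
theorem measure_map_withDensity_deriv_sq_le {f : ℝ → ℝ} (hf : ContDiff ℝ 2 f)
    (hs : HasCompactSupport (deriv f)) :
    (volume.withDensity fun t => ENNReal.ofReal (deriv f t ^ 2)).map f ≤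
      ENNReal.ofReal (∫ t, |deriv (deriv f) t|) • volume := by
  have hfc : Continuous f := hf.continuous
  have hf'c : Continuous (deriv f) := hf.continuous_deriv (by norm_num)
  have hint : Integrable fun t => deriv f t ^ 2 :=
    (hf'c.pow 2).integrable_of_hasCompactSupport
      (by simpa only [pow_two] using hs.mul_left (f := deriv f))
  have := isFiniteMeasure_withDensity_ofReal hint.2
  set ν := (volume.withDensity fun t => ENNReal.ofReal (deriv f t ^ 2)).map f with hν
  set C := ∫ t, |deriv (deriv f) t| with hC
  have hC0 : 0 ≤ C := integral_nonneg fun _ => abs_nonneg _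
  have hcomp : ∀ U K : Set ℝ, IsOpen U → IsCompact K → K ⊆ U → volume U ≠ ∞ →
      ν K ≤ ENNReal.ofReal C * volume U := by
    intro U K hU hK hKU hUt
    obtain ⟨g, hg0, hg1, hg⟩ := exists_continuous_zero_one_of_isClosed hU.isClosed_compl
      hK.isClosed (Set.disjoint_compl_left_iff_subset.2 hKU)
    have hgU : ∀ x, g x ≤ U.indicator 1 x := fun x => by
      by_cases hx : x ∈ U
      · simpa [hx] using (hg x).2
      · simpa [hx] using (hg0 hx).le
    have hgi : Integrable g := by
      refine Integrable.mono' (g := U.indicator 1)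
        ((integrable_indicator_iff hU.measurableSet).2 (integrableOn_const hUt))
        g.continuous.aestronglyMeasurable (Filter.Eventually.of_forall fun x => ?_)
      rw [Real.norm_of_nonneg (hg x).1]
      exact hgU x
    have hgI : ENNReal.ofReal (∫ y, g y) ≤ volume U := by
      rw [ofReal_integral_eq_lintegral_ofReal hgi (Filter.Eventually.of_forall fun x => (hg x).1),
        ← lintegral_indicator_one hU.measurableSet]
      refine lintegral_mono fun x => ?_
      refine (ENNReal.ofReal_le_ofReal (hgU x)).trans (le_of_eq ?_)
      by_cases hx : x ∈ U <;> simp [hx]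
    calc ν K = ∫⁻ t in f ⁻¹' K, ENNReal.ofReal (deriv f t ^ 2) := by
          rw [hν, Measure.map_apply hfc.measurable hK.measurableSet,
            withDensity_apply _ (hfc.measurable hK.measurableSet)]
      _ ≤ ∫⁻ t, ENNReal.ofReal (g (f t) * deriv f t ^ 2) := by
          rw [← lintegral_indicator (hfc.measurable hK.measurableSet)]
          refine lintegral_mono fun t => ?_
          by_cases ht : f t ∈ K
          · simp [ht, hg1 ht]
          · simp [ht]
      _ = ENNReal.ofReal (∫ t, g (f t) * deriv f t ^ 2) := by
          rw [ofReal_integral_eq_lintegral_ofReal]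
          · exact ((g.continuous.comp hfc).mul (hf'c.pow 2)).integrable_of_hasCompactSupport
              (by simpa only [pow_two] using (hs.mul_left (f := deriv f)).mul_left)
          · exact Filter.Eventually.of_forall fun t => mul_nonneg (hg _).1 (sq_nonneg _)
      _ ≤ ENNReal.ofReal (C * ∫ y, g y) := ENNReal.ofReal_le_ofReal
          (integral_comp_mul_deriv_sq_le hf hs g.continuous (fun x => (hg x).1) hgi)
      _ ≤ ENNReal.ofReal C * volume U := by
          rw [ENNReal.ofReal_mul hC0]
          gcongr
  have hopen : ∀ U : Set ℝ, IsOpen U → volume U ≠ ∞ → ν U ≤ ENNReal.ofReal C * volume U := by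
    intro U hU hUt
    rw [hU.measure_eq_iSup_isCompact ν]
    exact iSup_le fun K => iSup_le fun hKU => iSup_le fun hK => hcomp U K hU hK hKU hUt
  refine Measure.le_intro fun A hA _ => ?_
  rw [Measure.smul_apply, smul_eq_mul]
  by_cases hAt : volume A = ∞
  · rw [hAt]
    rcases hC0.eq_or_lt with h0 | h0
    · -- exhaust the set by bounded pieces, all of which are null when the constant vanishes
      rw [← h0, ENNReal.ofReal_zero, zero_mul, nonpos_iff_eq_zero]
      refine measure_mono_null (t := ⋃ n : ℕ, Set.Ioo (-(n : ℝ)) n) (fun x _ => ?_) ?_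
      · obtain ⟨n, hn⟩ := exists_nat_gt |x|
        exact Set.mem_iUnion.2 ⟨n, abs_lt.1 hn⟩
      · refine measure_iUnion_null fun n => ?_
        have := hopen (Set.Ioo (-(n : ℝ)) n) isOpen_Ioo (by simp)
        rw [← h0, ENNReal.ofReal_zero, zero_mul] at this
        exact nonpos_iff_eq_zero.1 this
    · rw [ENNReal.mul_top (by simpa using h0)]
      exact le_top
  refine ENNReal.le_of_forall_pos_le_add fun ε hε _ => ?_
  obtain ⟨U, hAU, hU, hUA⟩ := A.exists_isOpen_lt_add hAt
    (ε := ε / (ENNReal.ofReal C + 1)) (by simp [hε.ne'])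
  calc ν A ≤ ν U := measure_mono hAU
    _ ≤ ENNReal.ofReal C * volume U := hopen U hU (ne_top_of_lt hUA)
    _ ≤ ENNReal.ofReal C * (volume A + ε / (ENNReal.ofReal C + 1)) := by gcongr
    _ ≤ ENNReal.ofReal C * volume A + ε := by
        rw [mul_add]
        gcongr
        calc ENNReal.ofReal C * (ε / (ENNReal.ofReal C + 1))
            ≤ (ENNReal.ofReal C + 1) * (ε / (ENNReal.ofReal C + 1)) := by
              gcongr; exact le_self_add
          _ ≤ ε := ENNReal.mul_div_le

theorem lintegral_comp_mul_deriv_sq_le {f : ℝ → ℝ} (hf : ContDiff ℝ 2 f)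
    (hs : HasCompactSupport (deriv f)) {g : ℝ → ℝ≥0∞} (hg : Measurable g) :
    ∫⁻ t, g (f t) * ENNReal.ofReal (deriv f t ^ 2) ≤
      ENNReal.ofReal (∫ t, |deriv (deriv f) t|) * ∫⁻ y, g y := by
  have hf'c : Continuous (deriv f) := hf.continuous_deriv (by norm_num)
  have h := lintegral_mono' (measure_map_withDensity_deriv_sq_le hf hs) (le_refl g)
  rw [lintegral_smul_measure, smul_eq_mul, lintegral_map hg hf.continuous.measurable] at h
  change ∫⁻ t, (g ∘ f) t ∂_ ≤ _ at h
  rw [lintegral_withDensity_eq_lintegral_mul _ (by fun_prop)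
    (hg.comp hf.continuous.measurable)] at h
  simpa only [Pi.mul_apply, Function.comp_apply, mul_comm] using h

/-! ### Components of a curve -/

namespace IsCurve

variable {c : ℝ → Plane}

theorem hasDerivAt_apply (hc : IsCurve c) (i : Fin 2) (t : ℝ) :
    HasDerivAt (fun τ => c τ i) (deriv c t i) t :=
  (EuclideanSpace.proj (𝕜 := ℝ) i : Plane →L[ℝ] ℝ).hasFDerivAt.comp_hasDerivAt t
    (hc.smooth.differentiable (by simp) t).hasDerivAt

theorem deriv_apply (hc : IsCurve c) (i : Fin 2) :
    deriv (fun τ => c τ i) = fun t => deriv c t i :=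
  funext fun t => (hc.hasDerivAt_apply i t).deriv

theorem contDiff_apply (hc : IsCurve c) (i : Fin 2) : ContDiff ℝ 2 fun τ => c τ i :=
  ((EuclideanSpace.proj (𝕜 := ℝ) i : Plane →L[ℝ] ℝ).contDiff.comp hc.smooth).of_le
    (WithTop.coe_le_coe.2 (le_top : (2 : ℕ∞) ≤ ⊤))

theorem continuous_apply (hc : IsCurve c) (i : Fin 2) : Continuous fun τ => c τ i :=
  (hc.contDiff_apply i).continuous

theorem continuous_deriv_apply (hc : IsCurve c) (i : Fin 2) : Continuous fun τ => deriv c τ i := by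
  rw [← hc.deriv_apply i]
  exact (hc.contDiff_apply i).continuous_deriv (by norm_num)

theorem hasCompactSupport_deriv_apply (hc : IsCurve c) (i : Fin 2) :
    HasCompactSupport fun τ => deriv c τ i := by
  have : HasCompactSupport (deriv c) := isCompact_Icc.of_isClosed_subset isClosed_closure hc.supp
  exact this.comp_left (g := fun x : Plane => x i) rfl

theorem exists_abs_deriv_apply_le (hc : IsCurve c) (i : Fin 2) : ∃ D, ∀ t, |deriv c t i| ≤ D :=
  (hc.continuous_deriv_apply i).bounded_above_of_compact_support
    (hc.hasCompactSupport_deriv_apply i)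

theorem exists_apply_le (hc : IsCurve c) (i : Fin 2) :
    ∃ R, ∀ t ∈ Set.Icc (0 : ℝ) 1, c t i ≤ R := by
  obtain ⟨R, hR⟩ := (isCompact_Icc (a := (0 : ℝ)) (b := 1)).bddAbove_image
    (hc.continuous_apply i).continuousOn
  exact ⟨R, fun t ht => hR (Set.mem_image_of_mem _ ht)⟩

end IsCurve

/-! ### The surface swept out below a curve -/

/-- The point `(x₁, c₂(τ))` of the plane that corresponds to the parameters `p = (τ, x₁)`. -/
noncomputable def sweep (c : ℝ → Plane) (p : ℝ × ℝ) : Plane := !₂[p.2, c p.1 1]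

/-- The parameters `(τ, x₁)` with `s < τ ≤ t` and `0 < x₁ ≤ c₁(τ)`. -/
def sweepRegion (c : ℝ → Plane) (s t : ℝ) : Set (ℝ × ℝ) :=
  {p | p.1 ∈ Set.Ioc s t ∧ p.2 ∈ Set.Ioc 0 (c p.1 0)}

/-- Lebesgue measure on `sweepRegion c s t`. -/
noncomputable def sweepMeasure (c : ℝ → Plane) (s t : ℝ) : Measure (ℝ × ℝ) :=
  volume.restrict (sweepRegion c s t)

variable {c : ℝ → Plane} {s t : ℝ}

theorem IsCurve.continuous_sweep (hc : IsCurve c) : Continuous (sweep c) := by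
  have := hc.continuous_apply 1
  refine (PiLp.continuous_toLp 2 _).comp (continuous_pi fun i => ?_)
  fin_cases i
  · exact continuous_snd
  · exact this.comp continuous_fst

theorem lintegral_plane {φ : Plane → ℝ≥0∞} (hφ : Measurable φ) :
    ∫⁻ x, φ x = ∫⁻ a : ℝ, ∫⁻ b : ℝ, φ !₂[a, b] := by
  rw [← (PiLp.volume_preserving_toLp (Fin 2)).lintegral_comp hφ,
    ← (volume_preserving_finTwoArrow ℝ).symm.lintegral_comp (by fun_prop), Measure.volume_eq_prod,
    lintegral_prod _ (by fun_prop)]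
  rfl

/-- Weighted by `ċ₂²`, the map `sweep c` pushes Lebesgue measure to a measure with bounded
density. -/
theorem IsCurve.lintegral_sweep_le (hc : IsCurve c) {φ : Plane → ℝ≥0∞} (hφ : Measurable φ) :
    ∫⁻ p, φ (sweep c p) * ENNReal.ofReal (deriv c p.1 1 ^ 2) ≤
      ENNReal.ofReal (∫ t, |deriv (deriv fun τ => c τ 1) t|) * ∫⁻ x, φ x := by
  have h1 := hc.continuous_sweep
  have h2 := hc.continuous_deriv_apply 1
  rw [Measure.volume_eq_prod, lintegral_prod_symm _ (by fun_prop), lintegral_plane hφ,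
    ← lintegral_const_mul]
  · refine lintegral_mono fun a => ?_
    have := lintegral_comp_mul_deriv_sq_le (hc.contDiff_apply 1)
      (by rw [hc.deriv_apply]; exact hc.hasCompactSupport_deriv_apply 1)
      (g := fun b => φ !₂[a, b]) (by fun_prop)
    rw [hc.deriv_apply 1] at this ⊢
    exact this
  · exact Measurable.lintegral_prod_right' (f := fun p : ℝ × ℝ => φ !₂[p.1, p.2]) (by fun_prop)

/-- Where `ċ₂ ≠ 0`, the map `sweep c` pulls null sets back to null sets, so that functions on the
plane that are only defined almost everywhere can be composed with it. -/
theorem IsCurve.ae_sweep (hc : IsCurve c) {P : Plane → Prop} (h : ∀ᵐ x, P x) :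
    ∀ᵐ p : ℝ × ℝ, deriv c p.1 1 ≠ 0 → P (sweep c p) := by
  have h1 := hc.continuous_sweep
  have h2 := hc.continuous_deriv_apply 1
  obtain ⟨N, hPN, hN, hN0⟩ := exists_measurable_superset_of_null h
  have hmeas : Measurable fun p =>
      N.indicator (1 : Plane → ℝ≥0∞) (sweep c p) * ENNReal.ofReal (deriv c p.1 1 ^ 2) :=
    ((measurable_one.indicator hN).comp h1.measurable).mul (by fun_prop)
  have := hc.lintegral_sweep_le (φ := N.indicator 1) (measurable_one.indicator hN)
  rw [lintegral_indicator_one hN, hN0, mul_zero, nonpos_iff_eq_zero,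
    lintegral_eq_zero_iff hmeas] at this
  filter_upwards [this] with p hp h0
  by_contra hP
  have : sweep c p ∈ N := hPN hP
  simp only [Set.indicator_of_mem this, Pi.one_apply, one_mul, Pi.zero_apply,
    ENNReal.ofReal_eq_zero] at hp
  exact absurd hp (not_le.2 (by positivity))

theorem IsCurve.measurableSet_sweepRegion (hc : IsCurve c) (s t : ℝ) :
    MeasurableSet (sweepRegion c s t) := by
  have := hc.continuous_apply 0
  refine (measurable_fst measurableSet_Ioc).inter ?_
  exact (measurableSet_lt measurable_const measurable_snd).inter
    (measurableSet_le measurable_snd (this.measurable.comp measurable_fst))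

theorem sweepRegion_subset {R : ℝ} (hR : ∀ τ ∈ Set.Icc (0 : ℝ) 1, c τ 0 ≤ R) (hs : 0 ≤ s)
    (ht : t ≤ 1) : sweepRegion c s t ⊆ Set.Ioc s t ×ˢ Set.Ioc 0 R := fun _ hp =>
  ⟨hp.1, hp.2.1, hp.2.2.trans (hR _ ⟨hs.trans hp.1.1.le, hp.1.2.trans ht⟩)⟩

theorem sweepMeasure_univ_le {R : ℝ} (hR : ∀ τ ∈ Set.Icc (0 : ℝ) 1, c τ 0 ≤ R) (hs : 0 ≤ s)
    (ht : t ≤ 1) :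
    sweepMeasure c s t Set.univ ≤ ENNReal.ofReal (t - s) * ENNReal.ofReal R := by
  rw [sweepMeasure, Measure.restrict_apply_univ]
  refine (measure_mono (sweepRegion_subset hR hs ht)).trans ?_
  rw [Measure.volume_eq_prod, Measure.prod_prod, Real.volume_Ioc, Real.volume_Ioc, sub_zero]

theorem IsCurve.isFiniteMeasure_sweepMeasure (hc : IsCurve c) (hs : 0 ≤ s) (ht : t ≤ 1) :
    IsFiniteMeasure (sweepMeasure c s t) := by
  obtain ⟨R, hR⟩ := hc.exists_apply_le 0
  exact ⟨(sweepMeasure_univ_le hR hs ht).trans_lt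
    (ENNReal.mul_lt_top ENNReal.ofReal_lt_top ENNReal.ofReal_lt_top)⟩

theorem IsCurve.integral_sweepMeasure (hc : IsCurve c) {V : Type*} [NormedAddCommGroup V]
    [NormedSpace ℝ V] (hst : s ≤ t) {G : ℝ × ℝ → V} (hG : Integrable G (sweepMeasure c s t)) :
    ∫ p, G p ∂sweepMeasure c s t = ∫ τ in s..t, ∫ ξ in (0 : ℝ)..c τ 0, G (τ, ξ) := by
  have hm := hc.measurableSet_sweepRegion s t
  have hG' : Integrable ((sweepRegion c s t).indicator G) := (integrable_indicator_iff hm).2 hG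
  rw [sweepMeasure, ← integral_indicator hm, Measure.volume_eq_prod,
    integral_prod _ (by rwa [← Measure.volume_eq_prod]), intervalIntegral.integral_of_le hst,
    ← integral_indicator measurableSet_Ioc]
  congr 1
  funext τ
  by_cases hτ : τ ∈ Set.Ioc s t
  · rw [Set.indicator_of_mem hτ, intervalIntegral.integral_of_le (hc.pos τ).le,
      ← integral_indicator measurableSet_Ioc]
    congr 1
    funext ξ
    have : (τ, ξ) ∈ sweepRegion c s t ↔ ξ ∈ Set.Ioc 0 (c τ 0) := ⟨fun h => h.2, fun h => ⟨hτ, h⟩⟩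
    simp only [Set.indicator, this]
  · rw [Set.indicator_of_notMem hτ]
    refine integral_eq_zero_of_ae (Filter.Eventually.of_forall fun ξ => ?_)
    exact Set.indicator_of_notMem (fun h => hτ h.1) _

theorem IsCurve.memLp_sweep (hc : IsCurve c) (H : Lp ℝ 2 (volume : Measure Plane)) :
    MemLp (fun p : ℝ × ℝ => H (sweep c p) * deriv c p.1 1) 2 (sweepMeasure c s t) ∧
    eLpNorm (fun p : ℝ × ℝ => H (sweep c p) * deriv c p.1 1) 2 (sweepMeasure c s t) ≤
      ENNReal.ofReal (∫ t, |deriv (deriv fun τ => c τ 1) t|) ^ (1 / 2 : ℝ) * ‖H‖ₑ := by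
  have h1 := hc.continuous_sweep
  have h2 := hc.continuous_deriv_apply 1
  have hH : StronglyMeasurable H := Lp.stronglyMeasurable H
  have hm : StronglyMeasurable fun p : ℝ × ℝ => H (sweep c p) * deriv c p.1 1 :=
    (hH.comp_measurable h1.measurable).mul (h2.comp continuous_fst).stronglyMeasurable
  have hle : eLpNorm (fun p : ℝ × ℝ => H (sweep c p) * deriv c p.1 1) 2 (sweepMeasure c s t) ≤
      ENNReal.ofReal (∫ t, |deriv (deriv fun τ => c τ 1) t|) ^ (1 / 2 : ℝ) * ‖H‖ₑ := by
    rw [Lp.enorm_def, eLpNorm_eq_lintegral_rpow_enorm_toReal (by simp) (by simp),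
      eLpNorm_eq_lintegral_rpow_enorm_toReal (by simp) (by simp),
      ENNReal.toReal_ofNat, ← ENNReal.mul_rpow_of_nonneg _ _ (by norm_num)]
    simp only [ENNReal.rpow_ofNat]
    gcongr
    refine (lintegral_mono' Measure.restrict_le_self le_rfl).trans (le_trans (le_of_eq ?_)
      (hc.lintegral_sweep_le (φ := fun x => ‖H x‖ₑ ^ 2) (hH.measurable.enorm.pow_const 2)))
    refine lintegral_congr fun p => ?_
    rw [enorm_mul, mul_pow, ← Real.enorm_of_nonneg (sq_nonneg _), enorm_pow]
  exact ⟨⟨hm.aestronglyMeasurable, hle.trans_lt (ENNReal.mul_lt_top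
    (ENNReal.rpow_lt_top_of_nonneg (by norm_num) ENNReal.ofReal_ne_top) (by simp))⟩, hle⟩

theorem IsCurve.integrable_sweep (hc : IsCurve c) (hs : 0 ≤ s) (ht : t ≤ 1)
    (H : Lp ℝ 2 (volume : Measure Plane)) :
    Integrable (fun p : ℝ × ℝ => H (sweep c p) * deriv c p.1 1) (sweepMeasure c s t) := by
  have := hc.isFiniteMeasure_sweepMeasure hs ht
  exact (hc.memLp_sweep H).1.integrable (by norm_num)

theorem IsCurve.pairing_eq (hc : IsCurve c) (hs : 0 ≤ s) (hst : s ≤ t) (ht : t ≤ 1)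
    (H : Lp ℝ 2 (volume : Measure Plane)) :
    pairing c H ((Set.Icc s t).indicator 1) =
      ∫ p, H (sweep c p) * deriv c p.1 1 ∂sweepMeasure c s t := by
  rw [hc.integral_sweepMeasure hst (hc.integrable_sweep hs ht H),
    intervalIntegral.integral_of_le hst, ← integral_Icc_eq_integral_Ioc,
    ← integral_indicator measurableSet_Icc, pairing]
  congr 1
  funext τ
  by_cases hτ : τ ∈ Set.Icc s t <;> simp [hτ, sweep]

theorem IsCurve.sweep_ae_eq (hc : IsCurve c) {F G : Plane → ℝ} (h : F =ᵐ[volume] G) :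
    (fun p : ℝ × ℝ => F (sweep c p) * deriv c p.1 1) =ᵐ[sweepMeasure c s t]
      fun p => G (sweep c p) * deriv c p.1 1 := by
  filter_upwards [ae_restrict_of_ae (hc.ae_sweep h)] with p hp
  by_cases h0 : deriv c p.1 1 = 0
  · simp [h0]
  · rw [hp h0]

/-- The vector `𝓔_c 1_{[s, t]}` exists: `H ↦ ∫ H(x₁, c₂(τ)) ċ₂(τ)` is a bounded functional on
`L²`. -/
theorem IsCurve.inner_curveOp (hc : IsCurve c) (hs : 0 ≤ s) (hst : s ≤ t) (ht : t ≤ 1)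
    (H : Lp ℝ 2 (volume : Measure Plane)) :
    inner ℝ H (curveOp c ((Set.Icc s t).indicator 1)) =
      ∫ p, H (sweep c p) * deriv c p.1 1 ∂sweepMeasure c s t := by
  have hfin := hc.isFiniteMeasure_sweepMeasure hs ht
  set A := ENNReal.ofReal (∫ t, |deriv (deriv fun τ => c τ 1) t|) ^ (1 / 2 : ℝ) with hA
  set B := sweepMeasure c s t Set.univ ^ (1 / 2 : ℝ) with hB
  have hA' : A ≠ ∞ := by simp [hA]
  have hB' : B ≠ ∞ := by simp [hB]
  let L : Lp ℝ 2 (volume : Measure Plane) →L[ℝ] ℝ := LinearMap.mkContinuous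
    { toFun := fun H => ∫ p, H (sweep c p) * deriv c p.1 1 ∂sweepMeasure c s t
      map_add' := fun F G => by
        rw [← integral_add (hc.integrable_sweep hs ht F) (hc.integrable_sweep hs ht G)]
        refine integral_congr_ae ((hc.sweep_ae_eq (Lp.coeFn_add F G)).trans ?_)
        exact Filter.Eventually.of_forall fun p => add_mul _ _ _
      map_smul' := fun a F => by
        rw [RingHom.id_apply, smul_eq_mul, ← integral_const_mul]
        refine integral_congr_ae ((hc.sweep_ae_eq (Lp.coeFn_smul a F)).trans ?_)
        exact Filter.Eventually.of_forall fun p => mul_assoc _ _ _ }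
    (A * B).toReal fun F => by
      rw [← toReal_enorm, ← toReal_enorm F, ← ENNReal.toReal_mul]
      refine ENNReal.toReal_mono (ENNReal.mul_ne_top (ENNReal.mul_ne_top hA' hB') (by simp)) ?_
      have h := hc.memLp_sweep (s := s) (t := t) F
      refine (enorm_integral_le_lintegral_enorm _).trans ?_
      rw [← eLpNorm_one_eq_lintegral_enorm]
      refine (eLpNorm_le_eLpNorm_mul_rpow_measure_univ (one_le_two) h.1.1).trans ?_
      calc _ ≤ (A * ‖F‖ₑ) * B := by
            refine mul_le_mul' h.2 (le_of_eq ?_)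
            rw [hB]; congr 1; norm_num
        _ = A * B * ‖F‖ₑ := by ring
  have hE : ∃ u : Lp ℝ 2 (volume : Measure Plane), ∀ H : Lp ℝ 2 (volume : Measure Plane),
      inner ℝ H u = pairing c H ((Set.Icc s t).indicator 1) := by
    refine ⟨(InnerProductSpace.toDual ℝ _).symm L, fun H => ?_⟩
    rw [real_inner_comm, InnerProductSpace.toDual_symm_apply, hc.pairing_eq hs hst ht]
    rfl
  rw [curveOp, dif_pos hE, hE.choose_spec H, hc.pairing_eq hs hst ht]

/-- Interpolation between `L^∞` and `L¹`: the square of the norm of `𝓔_c 1_{[s, t]}` in `L²` is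
linear in `t - s`. -/
theorem exists_norm_curveOp_sq_le (hc : c ∈ curvesRot) :
    ∃ A, 0 ≤ A ∧ ∀ s t : ℝ, 0 ≤ s → s ≤ t → t ≤ 1 →
      ‖curveOp c ((Set.Icc s t).indicator 1)‖ ^ 2 ≤ A * (t - s) := by
  obtain ⟨hc, hrot⟩ := hc
  obtain ⟨R, hR⟩ := hc.exists_apply_le 0
  obtain ⟨D, hD⟩ := hc.exists_abs_deriv_apply_le 1
  have hR0 : 0 ≤ R := (hc.pos 0).le.trans (hR 0 (by simp))
  have hD0 : 0 ≤ D := (abs_nonneg _).trans (hD 0)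
  refine ⟨(rot c).toReal * D * R, by positivity, fun s t hs hst ht => ?_⟩
  have hfin := hc.isFiniteMeasure_sweepMeasure hs ht
  set u := curveOp c ((Set.Icc s t).indicator 1) with hu
  have hur : ∀ᵐ x, ‖u x‖ ≤ (rot c).toReal := by
    filter_upwards [enorm_ae_le_eLpNormEssSup u volume] with x hx
    rw [← toReal_enorm]
    refine ENNReal.toReal_mono hrot.ne (hx.trans ?_)
    rw [← eLpNorm_exponent_top]
    exact le_iSup₂_of_le s t le_rfl
  have hbound : ∀ᵐ p ∂sweepMeasure c s t,
      ‖u (sweep c p) * deriv c p.1 1‖ ≤ (rot c).toReal * D := by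
    filter_upwards [ae_restrict_of_ae (hc.ae_sweep hur)] with p hp
    by_cases h0 : deriv c p.1 1 = 0
    · rw [h0, mul_zero, norm_zero]; positivity
    · rw [norm_mul]
      exact mul_le_mul (hp h0) (hD _) (norm_nonneg _) ENNReal.toReal_nonneg
  rw [← real_inner_self_eq_norm_sq, hu, hc.inner_curveOp hs hst ht, ← hu]
  refine (Real.le_norm_self _).trans ((norm_integral_le_of_norm_le_const hbound).trans ?_)
  have hM : (sweepMeasure c s t).real Set.univ ≤ (t - s) * R := by
    refine ENNReal.toReal_le_of_le_ofReal (mul_nonneg (sub_nonneg.2 hst) hR0) ?_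
    rw [ENNReal.ofReal_mul (sub_nonneg.2 hst)]
    exact sweepMeasure_univ_le hR hs ht
  calc (rot c).toReal * D * (sweepMeasure c s t).real Set.univ
      ≤ (rot c).toReal * D * ((t - s) * R) := by gcongr
    _ = (rot c).toReal * D * R * (t - s) := by ring

/-! ### Translates of a Schwartz function and Young's inequality -/

section Translation

variable {E F : Type*} [NormedAddCommGroup E] [NormedSpace ℝ E] [NormedAddCommGroup F]
  [NormedSpace ℝ F]

/-- The mean value inequality for the `n`-th derivative; the weight `‖x‖ ^ k` is comparable to
`(1 + ‖z‖) ^ k` along the segment since the translation has length at most `1`. -/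
theorem exists_seminorm_compSubConst_sub_le (f : 𝓢(E, F)) (k n : ℕ) :
    ∃ C, 0 ≤ C ∧ ∀ a : E, ‖a‖ ≤ 1 →
      SchwartzMap.seminorm ℝ k n (SchwartzMap.compSubConstCLM ℝ a f - f) ≤ C * ‖a‖ := by
  set C := 2 ^ k * ((Finset.Iic (k, n + 1)).sup fun m => SchwartzMap.seminorm ℝ m.1 m.2) f with hC
  have hC0 : 0 ≤ C := by positivity
  refine ⟨C, hC0, fun a ha => SchwartzMap.seminorm_le_bound ℝ k n _ (by positivity) fun x => ?_⟩
  have hD : Differentiable ℝ (iteratedFDeriv ℝ n f) :=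
    (f.smooth ⊤).differentiable_iteratedFDeriv (by exact_mod_cast ENat.natCast_lt_top n)
  have hsub : iteratedFDeriv ℝ n (⇑(SchwartzMap.compSubConstCLM ℝ a f - f)) x =
      iteratedFDeriv ℝ n f (x - a) - iteratedFDeriv ℝ n f x := by
    have : ⇑(SchwartzMap.compSubConstCLM ℝ a f - f) = (fun y => f (y - a)) - ⇑f := by
      ext y; simp
    rw [this, iteratedFDeriv_sub_apply, iteratedFDeriv_comp_sub]
    · exact ((f.smooth n).comp (contDiff_id.sub contDiff_const)).contDiffAt
    · exact (f.smooth n).contDiffAt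
  have hfd : ∀ z, fderiv ℝ (fun y => ‖x‖ ^ k • iteratedFDeriv ℝ n f y) z =
      ‖x‖ ^ k • fderiv ℝ (iteratedFDeriv ℝ n f) z := fun z => fderiv_fun_const_smul (hD z) _
  have h := (convex_segment x (x - a)).norm_image_sub_le_of_norm_fderiv_le (𝕜 := ℝ) (C := C)
    (f := fun y => ‖x‖ ^ k • iteratedFDeriv ℝ n f y) (fun z _ => (hD z).fun_const_smul _)
    (fun z hz => by
      rw [hfd, norm_smul, norm_fderiv_iteratedFDeriv, norm_pow, norm_norm]
      refine le_trans ?_ (SchwartzMap.one_add_le_sup_seminorm_apply (𝕜 := ℝ) (m := (k, n + 1))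
        le_rfl le_rfl f z)
      gcongr
      have h1 : ‖x - z‖ ≤ ‖a‖ := by
        obtain ⟨θ, hθ, rfl⟩ := (segment_eq_image' ℝ x (x - a)) ▸ hz
        simp only [sub_sub_cancel_left, smul_neg]
        rw [← sub_eq_add_neg, sub_sub_cancel, norm_smul, Real.norm_of_nonneg hθ.1]
        exact mul_le_of_le_one_left (norm_nonneg _) hθ.2
      calc ‖x‖ = ‖(x - z) + z‖ := by rw [sub_add_cancel]
        _ ≤ ‖x - z‖ + ‖z‖ := norm_add_le _ _
        _ ≤ 1 + ‖z‖ := by linarith)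
    (left_mem_segment ℝ _ _) (right_mem_segment ℝ _ _)
  rw [hsub]
  rw [← smul_sub, norm_smul, norm_pow, norm_norm, sub_sub_cancel_left, norm_neg] at h
  exact h

theorem continuous_compSubConst (f : 𝓢(E, F)) :
    Continuous fun a : E => SchwartzMap.compSubConstCLM ℝ a f := by
  rw [continuous_iff_continuousAt]
  intro a
  refine ((schwartz_withSeminorms ℝ E F).tendsto_nhds _ _).2 fun m ε hε => ?_
  obtain ⟨C, hC0, hC⟩ :=
    exists_seminorm_compSubConst_sub_le (SchwartzMap.compSubConstCLM ℝ a f) m.1 m.2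
  have hlim : Filter.Tendsto (fun b => ‖b - a‖) (nhds a) (nhds 0) := by
    have : Continuous fun b : E => ‖b - a‖ := by fun_prop
    simpa using this.tendsto a
  filter_upwards [hlim.eventually_lt_const zero_lt_one,
    hlim.eventually_lt_const (u := ε / (C + 1)) (by positivity)] with b hb1 hb2
  have h := hC (b - a) hb1.le
  rw [SchwartzMap.compSubConstCLM_comp, add_sub_cancel] at h
  refine h.trans_lt ?_
  rw [lt_div_iff₀ (by positivity)] at hb2
  nlinarith [norm_nonneg (b - a)]

end Translation

theorem continuous_reflect (K : 𝓢(Plane, ℝ)) : Continuous (reflect K) :=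
  continuous_compSubConst _

/-- The translates of a kernel, as elements of `L²`. -/
noncomputable def reflectL2 (K : 𝓢(Plane, ℝ)) (x : Plane) : Lp ℝ 2 (volume : Measure Plane) :=
  (reflect K x).toLp 2 volume

theorem continuous_reflectL2 (K : 𝓢(Plane, ℝ)) : Continuous (reflectL2 K) :=
  SchwartzMap.continuous_toLp.comp (continuous_reflect K)

/-- Young's inequality `‖K * H‖₂ ≤ ‖K‖₁ ‖H‖₂`. -/
theorem eLpNorm_inner_reflectL2_le (K : 𝓢(Plane, ℝ)) (H : Lp ℝ 2 (volume : Measure Plane)) :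
    eLpNorm (fun x => inner ℝ H (reflectL2 K x)) 2 volume ≤ (∫⁻ x, ‖K x‖ₑ) * ‖H‖ₑ := by
  have hH : Measurable fun y => ‖H y‖ₑ ^ 2 :=
    (Lp.stronglyMeasurable H).measurable.enorm.pow_const 2
  have hKm : Measurable fun y => ‖K y‖ₑ := K.continuous.measurable.enorm
  have hpt : ∀ x, ‖inner ℝ H (reflectL2 K x)‖ₑ ^ 2 ≤
      (∫⁻ x, ‖K x‖ₑ) * ∫⁻ y, ‖H y‖ₑ ^ 2 * ‖K (x - y)‖ₑ := by
    intro x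
    have hi : (inner ℝ H (reflectL2 K x) : ℝ) = ∫ y, K (x - y) * H y := by
      rw [L2.inner_def]
      refine integral_congr_ae ?_
      filter_upwards [(reflect K x).coeFn_toLp 2 volume] with y hy
      rw [reflectL2, hy, reflect_apply]
      rfl
    have hk : ∀ y, ‖K (x - y) * H y‖ₑ =
        ‖K (x - y)‖ₑ ^ (1 / 2 : ℝ) * (‖H y‖ₑ * ‖K (x - y)‖ₑ ^ (1 / 2 : ℝ)) := fun y => by
      rw [enorm_mul, mul_left_comm, ← ENNReal.rpow_add_of_nonneg _ _ (by norm_num) (by norm_num)]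
      norm_num [mul_comm]
    have hmK : Measurable fun y => ‖K (x - y)‖ₑ :=
      (hKm.comp (measurable_const.sub measurable_id))
    have hCS := ENNReal.lintegral_mul_le_Lp_mul_Lq volume Real.HolderConjugate.two_two
      (f := fun y => ‖K (x - y)‖ₑ ^ (1 / 2 : ℝ)) (g := fun y => ‖H y‖ₑ * ‖K (x - y)‖ₑ ^ (1 / 2 : ℝ))
      (hmK.pow_const _).aemeasurable
      ((Lp.stronglyMeasurable H).measurable.enorm.mul (hmK.pow_const _)).aemeasurable
    have hsq : ∀ a : ℝ≥0∞, (a ^ (1 / 2 : ℝ)) ^ 2 = a := fun a => by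
      rw [← ENNReal.rpow_natCast, ← ENNReal.rpow_mul]; norm_num
    calc ‖inner ℝ H (reflectL2 K x)‖ₑ ^ 2 ≤ (∫⁻ y, ‖K (x - y) * H y‖ₑ) ^ 2 := by
          rw [hi]; gcongr; exact enorm_integral_le_lintegral_enorm _
      _ ≤ ((∫⁻ y, ‖K (x - y)‖ₑ) ^ (1 / 2 : ℝ) *
            (∫⁻ y, ‖H y‖ₑ ^ 2 * ‖K (x - y)‖ₑ) ^ (1 / 2 : ℝ)) ^ 2 := by
          simp_rw [hk]
          gcongr
          refine hCS.trans (le_of_eq ?_)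
          simp only [ENNReal.rpow_ofNat, hsq, mul_pow]
      _ = (∫⁻ y, ‖K (x - y)‖ₑ) * ∫⁻ y, ‖H y‖ₑ ^ 2 * ‖K (x - y)‖ₑ := by
          rw [mul_pow, hsq, hsq]
      _ = _ := by rw [lintegral_sub_left_eq_self (fun y => ‖K y‖ₑ) x]
  have hmain : ∫⁻ x, ‖inner ℝ H (reflectL2 K x)‖ₑ ^ 2 ≤
      (∫⁻ x, ‖K x‖ₑ) ^ 2 * ∫⁻ y, ‖H y‖ₑ ^ 2 := by
    calc _ ≤ ∫⁻ x, (∫⁻ x, ‖K x‖ₑ) * ∫⁻ y, ‖H y‖ₑ ^ 2 * ‖K (x - y)‖ₑ := lintegral_mono hpt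
      _ = (∫⁻ x, ‖K x‖ₑ) * ∫⁻ y, ∫⁻ x, ‖H y‖ₑ ^ 2 * ‖K (x - y)‖ₑ := by
          have hm : Measurable fun p : Plane × Plane => ‖H p.2‖ₑ ^ 2 * ‖K (p.1 - p.2)‖ₑ :=
            (hH.comp measurable_snd).mul (hKm.comp (measurable_fst.sub measurable_snd))
          rw [lintegral_const_mul _ hm.lintegral_prod_right', lintegral_lintegral_swap
            hm.aemeasurable]
      _ = (∫⁻ x, ‖K x‖ₑ) * ∫⁻ y, ‖H y‖ₑ ^ 2 * ∫⁻ x, ‖K x‖ₑ := by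
          congr 1
          refine lintegral_congr fun y => ?_
          have hm : Measurable fun x => ‖K (x - y)‖ₑ :=
            hKm.comp (measurable_id.sub measurable_const)
          rw [lintegral_const_mul _ hm, lintegral_sub_right_eq_self (fun x => ‖K x‖ₑ) y]
      _ = _ := by rw [lintegral_mul_const _ hH]; ring
  rw [Lp.enorm_def, eLpNorm_eq_lintegral_rpow_enorm_toReal (by simp) (by simp),
    eLpNorm_eq_lintegral_rpow_enorm_toReal (by simp) (by simp)]
  simp only [ENNReal.toReal_ofNat, ENNReal.rpow_ofNat]
  refine (ENNReal.rpow_le_rpow hmain (by norm_num)).trans (le_of_eq ?_)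
  rw [ENNReal.mul_rpow_of_nonneg _ _ (by norm_num), ← ENNReal.rpow_natCast, ← ENNReal.rpow_mul]
  norm_num

/-! ### The low-pass kernels -/

namespace LPBump

variable (ρ : LPBump)

theorem chi_add (ξ : Plane) : ρ.chi ξ + ρ.toFun ξ = ρ.chi ((1 / 2 : ℝ) • ξ) := by
  by_cases h0 : ξ = 0
  · rw [h0, smul_zero, ρ.eq_zero_of_lt (by norm_num), add_zero]
  have h0' : (1 / 2 : ℝ) • ξ ≠ 0 := smul_ne_zero (by norm_num) h0
  have hsm : ∀ k : ℕ, (2 : ℝ) ^ (k + 1) • (1 / 2 : ℝ) • ξ = (2 : ℝ) ^ k • ξ := fun k => by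
    rw [smul_smul, pow_succ]; congr 1; ring
  rw [chi, chi, if_neg h0, if_neg h0']
  simp_rw [hsm]
  have hsum : Summable fun k : ℕ => ρ.toFun ((2 : ℝ) ^ k • ξ) := by
    obtain ⟨N, hN⟩ := pow_unbounded_of_one_lt (2 / ‖ξ‖) (one_lt_two : (1 : ℝ) < 2)
    refine summable_of_ne_finset_zero (s := Finset.range N) fun k hk => ρ.eq_zero_of_gt ?_
    have hk' : (2 : ℝ) ^ N ≤ 2 ^ k := pow_le_pow_right₀ one_le_two (by simpa using hk)
    rw [norm_smul, norm_pow, Real.norm_ofNat, ← div_lt_iff₀ (norm_pos_iff.2 h0)]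
    exact hN.trans_le hk'
  rw [hsum.tsum_eq_zero_add, pow_zero, one_smul, add_comm]

/-- The dyadic partition of unity telescopes. -/
theorem sum_mult (m : ℕ) (ξ : Plane) :
    ∑ i ∈ Finset.Ico (-1) (m : ℤ), ρ.mult i ξ = ρ.chi (((2 : ℝ) ^ m)⁻¹ • ξ) := by
  induction m with
  | zero =>
    have : Finset.Ico (-1) ((0 : ℕ) : ℤ) = {-1} := by decide
    rw [this]
    simp [mult]
  | succ m ih =>
    rw [Nat.cast_succ, ← Finset.insert_Ico_right_eq_Ico_add_one (by omega),
      Finset.sum_insert (by simp), ih, mult, if_neg (by omega), zpow_neg, zpow_natCast, add_comm,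
      chi_add, smul_smul, pow_succ]
    congr 2
    ring

/-- The kernel of the low-pass operator `S_j`. -/
noncomputable def lowPassKernel (j : ℤ) : 𝓢(Plane, ℝ) :=
  ∑ i ∈ Finset.Ico (-1) j, ρ.kernel i

theorem lowPass_eq {V : Type*} [NormedAddCommGroup V] [NormedSpace ℝ V] (j : ℤ)
    (u : 𝓢(Plane, ℝ) →L[ℝ] V) (x : Plane) :
    ρ.lowPass j u x = u (reflect (ρ.lowPassKernel j) x) := by
  simp only [lowPass, delta, lowPassKernel, reflect, map_sum]

theorem lowPassKernel_apply (m : ℕ) (x : Plane) :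
    ρ.lowPassKernel m x = ((2 : ℝ) ^ m) ^ 2 * ρ.kernel (-1) ((2 : ℝ) ^ m • x) := by
  have h1 : ρ.lowPassKernel m x =
      ((𝓕⁻ (∑ i ∈ Finset.Ico (-1) (m : ℤ), ρ.multSchwartz i) : 𝓢(Plane, ℂ)) x).re := by
    have : (𝓕⁻ (∑ i ∈ Finset.Ico (-1) (m : ℤ), ρ.multSchwartz i) : 𝓢(Plane, ℂ)) =
        ∑ i ∈ Finset.Ico (-1) (m : ℤ), 𝓕⁻ (ρ.multSchwartz i) :=
      map_sum (FourierTransform.fourierInvCLM ℂ 𝓢(Plane, ℂ)) _ _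
    rw [this, lowPassKernel, sum_apply, sum_apply, Complex.re_sum]
    rfl
  have h2 : ∀ v, (∑ i ∈ Finset.Ico (-1) (m : ℤ), ρ.multSchwartz i) v =
      ρ.multSchwartz (-1) (((2 : ℝ) ^ m)⁻¹ • v) := fun v => by
    have hv := ρ.sum_mult m ((2 * Real.pi) • v)
    rw [sum_apply]
    change ∑ i ∈ Finset.Ico (-1) (m : ℤ), (ρ.mult i ((2 * Real.pi) • v) : ℂ) =
      (ρ.mult (-1) ((2 * Real.pi) • ((2 : ℝ) ^ m)⁻¹ • v) : ℂ)
    rw [← Complex.ofReal_sum, hv, smul_comm, mult, if_pos (by norm_num)]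
  have h3 : (𝓕⁻ (∑ i ∈ Finset.Ico (-1) (m : ℤ), ρ.multSchwartz i) : 𝓢(Plane, ℂ)) x =
      (((2 : ℝ) ^ m) ^ 2 : ℝ) • (𝓕⁻ (ρ.multSchwartz (-1)) : 𝓢(Plane, ℂ)) ((2 : ℝ) ^ m • x) := by
    rw [SchwartzMap.fourierInv_coe, SchwartzMap.fourierInv_coe, Real.fourierInv_eq,
      Real.fourierInv_eq]
    -- substitute `2 ^ m • v` for `v` in the Fourier integral over the plane
    have := Measure.integral_comp_inv_smul_of_nonneg (volume : Measure Plane)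
      (fun v => 𝐞 (inner ℝ v ((2 : ℝ) ^ m • x)) • ρ.multSchwartz (-1) v)
      (R := (2 : ℝ) ^ m) (by positivity)
    rw [finrank_euclideanSpace_fin] at this
    rw [← this]
    refine integral_congr_ae (Filter.Eventually.of_forall fun v => ?_)
    simp only [h2]
    congr 2
    rw [inner_smul_left, inner_smul_right, conj_trivial, inv_mul_cancel_left₀ (by positivity)]
  rw [h1, h3, Complex.smul_re]
  rfl

/-- The low-pass kernels are dilates of one Schwartz function, so that they are bounded in `L¹`. -/
theorem exists_lintegral_lowPassKernel_le :
    ∃ B : ℝ, 0 ≤ B ∧ ∀ j : ℤ, -1 ≤ j → ∫⁻ x, ‖ρ.lowPassKernel j x‖ₑ ≤ ENNReal.ofReal B := by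
  refine ⟨∫ x, ‖ρ.kernel (-1) x‖, by positivity, fun j hj => ?_⟩
  rw [← ofReal_integral_norm_eq_lintegral_enorm (ρ.lowPassKernel j).integrable]
  refine ENNReal.ofReal_le_ofReal ?_
  rcases hj.eq_or_lt with rfl | hj
  · simp only [lowPassKernel, Finset.Ico_self, Finset.sum_empty, zero_apply, norm_zero,
      integral_zero]
    positivity
  obtain ⟨m, rfl⟩ := Int.eq_ofNat_of_zero_le (by omega : 0 ≤ j)
  simp only [lowPassKernel_apply, norm_mul]
  have := Measure.integral_comp_smul_of_nonneg (volume : Measure Plane)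
    (fun x => ‖ρ.kernel (-1) x‖) ((2 : ℝ) ^ m) (hR := by positivity)
  rw [finrank_euclideanSpace_fin] at this
  rw [integral_const_mul, this, Real.norm_of_nonneg (by positivity), smul_eq_mul,
    mul_inv_cancel_left₀ (by positivity)]

end LPBump

/-! ### Riemann sums -/

section RiemannSum

variable {V V' : Type*}

/-- The sum `∑ M(Aᵢ) G(yᵢ)`, where the `Aᵢ` are the level sets of the `N`-th simple function that
approximates the identity and `yᵢ` is its value on `Aᵢ`. It makes sense with values in any real
vector space, in particular in the Schwartz space, in which there is no Bochner integral. -/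
noncomputable def riemannSum [AddCommGroup V] [Module ℝ V] (M : Measure (ℝ × ℝ)) (G : ℝ × ℝ → V)
    (N : ℕ) : V :=
  ∑ y ∈ (SimpleFunc.approxOn id measurable_id Set.univ (0 : ℝ × ℝ) trivial N).range,
    M.real (SimpleFunc.approxOn id measurable_id Set.univ (0 : ℝ × ℝ) trivial N ⁻¹' {y}) • G y

theorem map_riemannSum [AddCommGroup V] [Module ℝ V] [AddCommGroup V'] [Module ℝ V']
    (L : V →ₗ[ℝ] V') (M : Measure (ℝ × ℝ)) (G : ℝ × ℝ → V) (N : ℕ) :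
    L (riemannSum M G N) = riemannSum M (fun p => L (G p)) N := by
  simp only [riemannSum, map_sum, map_smul]

theorem tendsto_riemannSum [NormedAddCommGroup V] [NormedSpace ℝ V] [CompleteSpace V]
    {M : Measure (ℝ × ℝ)} [IsFiniteMeasure M] {r : ℝ} (hM : ∀ᵐ p ∂M, ‖p‖ ≤ r)
    {G : ℝ × ℝ → V} (hG : Continuous G) :
    Filter.Tendsto (riemannSum M G) Filter.atTop (nhds (∫ p, G p ∂M)) := by
  set a := fun N => SimpleFunc.approxOn id measurable_id Set.univ (0 : ℝ × ℝ) trivial N with ha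
  have hsum : ∀ N, riemannSum M G N = ∫ p, G (a N p) ∂M := by
    intro N
    have h : ∀ p, G (a N p) = ∑ y ∈ (a N).range, (a N ⁻¹' {y}).indicator (fun _ => G y) p := by
      intro p
      rw [Finset.sum_eq_single (a N p)]
      · rw [Set.indicator_of_mem (by simp)]
      · intro y _ hy
        exact Set.indicator_of_notMem (fun h => hy h.symm) _
      · exact fun h => absurd ((a N).mem_range_self p) h
    simp_rw [h]
    rw [integral_finsetSum _ fun y _ =>
      (integrable_const (G y)).indicator ((a N).measurableSet_fiber y)]
    refine Finset.sum_congr rfl fun y _ => ?_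
    rw [integral_indicator_const _ ((a N).measurableSet_fiber y)]
  obtain ⟨D, hD⟩ := (isCompact_closedBall (0 : ℝ × ℝ) (r + r)).exists_bound_of_continuousOn
    hG.continuousOn
  rw [funext hsum]
  refine tendsto_integral_of_dominated_convergence (fun _ => D)
    (fun N => ((a N).map G).aestronglyMeasurable) (integrable_const D) (fun N => ?_) ?_
  · filter_upwards [hM] with p hp
    refine hD _ (mem_closedBall_zero_iff.2 ?_)
    exact (SimpleFunc.norm_approxOn_zero_le measurable_id _ p N).trans (add_le_add hp hp)
  · refine Filter.Eventually.of_forall fun p => ?_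
    exact (hG.tendsto _).comp (SimpleFunc.tendsto_approxOn measurable_id _ (by simp))

end RiemannSum

/-! ### Line integrals as surface integrals -/

section LineIntegral

variable {c : ℝ → Plane} {s t : ℝ} {V : Type*} [NormedAddCommGroup V]

theorem IsCurve.integrable_sweepMeasure (hc : IsCurve c) (hs : 0 ≤ s) (ht : t ≤ 1)
    {G : ℝ × ℝ → V} (hG : Continuous G) : Integrable G (sweepMeasure c s t) := by
  obtain ⟨R, hR⟩ := hc.exists_apply_le 0
  have hcomp : IsCompact (Set.Icc s t ×ˢ Set.Icc 0 R) := isCompact_Icc.prod isCompact_Icc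
  exact (hG.continuousOn.integrableOn_compact hcomp).mono_set ((sweepRegion_subset hR hs ht).trans
    (Set.prod_mono Set.Ioc_subset_Icc_self Set.Ioc_subset_Icc_self))

theorem IsCurve.exists_norm_le_sweepMeasure (hc : IsCurve c) (hs : 0 ≤ s) (ht : t ≤ 1) :
    ∃ r, ∀ᵐ p ∂sweepMeasure c s t, ‖p‖ ≤ r := by
  obtain ⟨R, hR⟩ := hc.exists_apply_le 0
  obtain ⟨r, hr⟩ := ((isCompact_Icc (a := s) (b := t)).prod
    (isCompact_Icc (a := (0 : ℝ)) (b := R))).isBounded.exists_norm_le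
  refine ⟨r, (ae_restrict_iff' (hc.measurableSet_sweepRegion s t)).2
    (Filter.Eventually.of_forall fun p hp => hr p ?_)⟩
  exact Set.prod_mono Set.Ioc_subset_Icc_self Set.Ioc_subset_Icc_self
    (sweepRegion_subset hR hs ht hp)

theorem IsCurve.lineIntegral_axialGauge_sub [NormedSpace ℝ V] (hc : IsCurve c) (hs : 0 ≤ s)
    (hst : s ≤ t) (ht : t ≤ 1) {F : Plane → V} (hF : Continuous F) :
    lineIntegral c (axialGauge F) t - lineIntegral c (axialGauge F) s =
      ∫ p, deriv c p.1 1 • F (sweep c p) ∂sweepMeasure c s t := by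
  have h0 := hc.continuous_apply 0
  have h1 := hc.continuous_deriv_apply 1
  have h2 : Continuous fun p => F (sweep c p) := hF.comp hc.continuous_sweep
  have h3 : Continuous fun p : ℝ × ℝ => deriv c p.1 1 • F (sweep c p) :=
    (h1.comp continuous_fst).smul h2
  have hsum : ∀ τ, ∑ k, deriv c τ k • axialGauge F (c τ) k =
      deriv c τ 1 • ∫ ξ in (0 : ℝ)..c τ 0, F (sweep c (τ, ξ)) := fun τ => by
    simp [axialGauge, sweep]
  have hcont : Continuous fun τ => deriv c τ 1 • ∫ ξ in (0 : ℝ)..c τ 0, F (sweep c (τ, ξ)) :=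
    h1.smul (intervalIntegral.continuous_parametric_intervalIntegral_of_continuous
      (f := fun τ ξ => F (sweep c (τ, ξ))) h2 h0)
  simp only [lineIntegral, hsum]
  rw [intervalIntegral.integral_interval_sub_left (hcont.intervalIntegrable _ _)
    (hcont.intervalIntegrable _ _), hc.integral_sweepMeasure hst
    (hc.integrable_sweepMeasure hs ht h3)]
  simp only [intervalIntegral.integral_smul]

end LineIntegral

/-- The integral of the translates of `K` over the surface below the curve; this is the convolution
of `𝓔_c 1_{[s, t]}` with the reflection of `K`. -/
noncomputable def sweepKernel (K : 𝓢(Plane, ℝ)) (c : ℝ → Plane) (s t : ℝ) :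
    Lp ℝ 2 (volume : Measure Plane) :=
  ∫ p, deriv c p.1 1 • reflectL2 K (sweep c p) ∂sweepMeasure c s t

/-- By duality: `⟨Φ, Φ⟩ = ⟨K * Φ, 𝓔_c 1_{[s, t]}⟩` for `Φ = sweepKernel K c s t`, and Young's
inequality bounds `K * Φ`. -/
theorem IsCurve.norm_sweepKernel_le {c : ℝ → Plane} {s t : ℝ} (hc : IsCurve c) (hs : 0 ≤ s)
    (hst : s ≤ t) (ht : t ≤ 1) {K : 𝓢(Plane, ℝ)} {B : ℝ} (hB : 0 ≤ B)
    (hK : ∫⁻ x, ‖K x‖ₑ ≤ ENNReal.ofReal B) :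
    ‖sweepKernel K c s t‖ ≤ B * ‖curveOp c ((Set.Icc s t).indicator 1)‖ := by
  set Φ := sweepKernel K c s t with hΦ
  have h1 := hc.continuous_deriv_apply 1
  have h2 : Continuous fun p : ℝ × ℝ => deriv c p.1 1 • reflectL2 K (sweep c p) :=
    (h1.comp continuous_fst).smul ((continuous_reflectL2 K).comp hc.continuous_sweep)
  have hcont : Continuous fun x => (inner ℝ Φ (reflectL2 K x) : ℝ) :=
    continuous_const.inner (continuous_reflectL2 K)
  have hle : eLpNorm (fun x => (inner ℝ Φ (reflectL2 K x) : ℝ)) 2 volume ≤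
      ENNReal.ofReal B * ‖Φ‖ₑ :=
    (eLpNorm_inner_reflectL2_le K Φ).trans (mul_le_mul_left hK _)
  have hmem : MemLp (fun x => (inner ℝ Φ (reflectL2 K x) : ℝ)) 2 volume :=
    ⟨hcont.aestronglyMeasurable, hle.trans_lt (ENNReal.mul_lt_top (by simp) (by simp))⟩
  have hnorm : ‖hmem.toLp‖ ≤ B * ‖Φ‖ := by
    rw [Lp.norm_toLp]
    refine ENNReal.toReal_le_of_le_ofReal (by positivity) (hle.trans (le_of_eq ?_))
    rw [ENNReal.ofReal_mul hB, ofReal_norm]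
  have key : ‖Φ‖ ^ 2 = inner ℝ hmem.toLp (curveOp c ((Set.Icc s t).indicator 1)) := by
    rw [hc.inner_curveOp hs hst ht, integral_congr_ae (hc.sweep_ae_eq hmem.coeFn_toLp),
      ← real_inner_self_eq_norm_sq]
    calc (inner ℝ Φ Φ : ℝ)
        = inner ℝ Φ (∫ p, deriv c p.1 1 • reflectL2 K (sweep c p) ∂sweepMeasure c s t) := rfl
      _ = ∫ p, inner ℝ Φ (deriv c p.1 1 • reflectL2 K (sweep c p)) ∂sweepMeasure c s t :=
          (integral_inner (hc.integrable_sweepMeasure hs ht h2) Φ).symm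
      _ = _ := by simp only [inner_smul_right, mul_comm]
  have hmul : ‖Φ‖ * ‖Φ‖ ≤ ‖Φ‖ * (B * ‖curveOp c ((Set.Icc s t).indicator 1)‖) := by
    rw [← pow_two, key]
    refine (real_inner_le_norm _ _).trans ?_
    calc _ ≤ (B * ‖Φ‖) * ‖curveOp c ((Set.Icc s t).indicator 1)‖ := by gcongr
      _ = _ := by ring
  rcases (norm_nonneg Φ).eq_or_lt with h | h
  · rw [← h]; positivity
  · exact le_of_mul_le_mul_left hmul h

/-! ### Moments of white noise -/

namespace WhiteNoise

variable {n : ℕ} {Ω : Type*} [MeasurableSpace Ω] {P : Measure Ω}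

theorem map_inner_toL2 (W : WhiteNoise n P) (f : Lp ℝ 2 (volume : Measure Plane)) (X : su n) :
    P.map (fun ω => inner ℝ (W.toL2 f ω) X) =
      (gaussianReal 0 1).map fun x => ‖f‖ * ‖X‖ * x := by
  have hg := W.gaussian.hasGaussianLaw_eval (f, X)
  have hv : Var[fun ω => inner ℝ (W.toL2 f ω) X; P] = (‖f‖ * ‖X‖) ^ 2 := by
    rw [variance_of_integral_eq_zero hg.aemeasurable (W.mean f X), mul_pow,
      ← real_inner_self_eq_norm_sq, ← real_inner_self_eq_norm_sq, ← W.cov]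
    simp only [pow_two]
  rw [hg.map_eq_gaussianReal, gaussianReal_map_const_mul, W.mean f X, hv, mul_zero, mul_one]
  congr 1
  exact NNReal.eq (Real.coe_toNNReal _ (sq_nonneg _))

/-- The moments of a Gaussian vector are controlled by its covariance. -/
theorem eLpNorm_toL2_le (W : WhiteNoise n P) (f : Lp ℝ 2 (volume : Measure Plane)) {q : ℝ≥0∞}
    (hq : 1 ≤ q) :
    eLpNorm (W.toL2 f) q P ≤
      Module.finrank ℝ (su n) * eLpNorm id q (gaussianReal 0 1) * ‖f‖ₑ := by
  set b := stdOrthonormalBasis ℝ (su n) with hb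
  have hg := fun i => W.gaussian.hasGaussianLaw_eval (f, b i)
  have hi : ∀ i, eLpNorm (fun ω => inner ℝ (W.toL2 f ω) (b i) • b i) q P =
      eLpNorm id q (gaussianReal 0 1) * ‖f‖ₑ := by
    intro i
    calc eLpNorm (fun ω => inner ℝ (W.toL2 f ω) (b i) • b i) q P
        = eLpNorm (id ∘ fun ω => (inner ℝ (W.toL2 f ω) (b i) : ℝ)) q P :=
          eLpNorm_congr_norm_ae (Filter.Eventually.of_forall fun ω => by
            simp [norm_smul])
      _ = eLpNorm id q (P.map fun ω => (inner ℝ (W.toL2 f ω) (b i) : ℝ)) :=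
          (eLpNorm_map_measure aestronglyMeasurable_id (hg i).aemeasurable).symm
      _ = eLpNorm (id ∘ fun x => ‖f‖ * ‖b i‖ * x) q (gaussianReal 0 1) := by
          rw [W.map_inner_toL2, eLpNorm_map_measure aestronglyMeasurable_id (by fun_prop)]
      _ = eLpNorm (‖f‖ • id) q (gaussianReal 0 1) := by
          congr 1; ext x; simp
      _ = _ := by rw [eLpNorm_const_smul, enorm_norm, mul_comm]
  have hsum : (W.toL2 f : Ω → su n) =
      ∑ i, fun ω => inner ℝ (W.toL2 f ω) (b i) • b i := by
    ext1 ω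
    rw [Finset.sum_apply]
    conv_lhs => rw [← b.sum_repr (W.toL2 f ω)]
    refine Finset.sum_congr rfl fun i _ => ?_
    rw [b.repr_apply_apply, real_inner_comm]
  rw [hsum]
  refine (eLpNorm_sum_le (fun i _ => ?_) hq).trans (le_of_eq ?_)
  · exact ((hg i).aemeasurable.aestronglyMeasurable).smul_const (b i)
  · simp only [hi, Finset.sum_const, Finset.card_univ, Fintype.card_fin, nsmul_eq_mul, mul_assoc]

variable {c : ℝ → Plane} {s t : ℝ}

/-- The increment is a pointwise limit of Riemann sums, each of which is almost surely the white
noise evaluated at a Riemann sum of the integral `sweepKernel`. -/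
theorem memLp_increment (W : WhiteNoise n P) (ρ : LPBump) (hc : IsCurve c) (j : ℤ) (hs : 0 ≤ s)
    (hst : s ≤ t) (ht : t ≤ 1) {q : ℝ≥0∞} (hq : 1 ≤ q) (hq' : q ≠ ∞) :
    MemLp (W.increment ρ c j s t) q P ∧
    eLpNorm (W.increment ρ c j s t) q P ≤
      Module.finrank ℝ (su n) * eLpNorm id q (gaussianReal 0 1) *
        ‖sweepKernel (ρ.lowPassKernel j) c s t‖ₑ := by
  have hfin := hc.isFiniteMeasure_sweepMeasure hs ht
  obtain ⟨r, hr⟩ := hc.exists_norm_le_sweepMeasure hs ht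
  have hd : Continuous fun p : ℝ × ℝ => deriv c p.1 1 :=
    (hc.continuous_deriv_apply 1).comp continuous_fst
  have hK := continuous_reflect (ρ.lowPassKernel j)
  set ψ : ℕ → 𝓢(Plane, ℝ) := riemannSum (sweepMeasure c s t)
    fun p => deriv c p.1 1 • reflect (ρ.lowPassKernel j) (sweep c p) with hψ
  have hlim : ∀ ω, Filter.Tendsto (fun N => W.sample ω (ψ N)) Filter.atTop
      (nhds (W.increment ρ c j s t ω)) := by
    intro ω
    have happ : W.approx ρ j ω = fun x => W.sample ω (reflect (ρ.lowPassKernel j) x) :=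
      funext fun x => ρ.lowPass_eq j (W.sample ω) x
    have hF : Continuous (W.approx ρ j ω) := by
      rw [happ]; exact (W.sample ω).continuous.comp hK
    rw [increment, process, process, hc.lineIntegral_axialGauge_sub hs hst ht hF]
    have hG : Continuous fun p : ℝ × ℝ => deriv c p.1 1 • W.approx ρ j ω (sweep c p) :=
      hd.smul (hF.comp hc.continuous_sweep)
    refine (tendsto_riemannSum hr hG).congr fun N => ?_
    refine Eq.trans ?_ (map_riemannSum (W.sample ω).toLinearMap _ _ N).symm
    simp [happ]
  have hlim2 : Filter.Tendsto (fun N => (ψ N).toLp 2 volume) Filter.atTop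
      (nhds (sweepKernel (ρ.lowPassKernel j) c s t)) := by
    have hG : Continuous fun p : ℝ × ℝ =>
        deriv c p.1 1 • reflectL2 (ρ.lowPassKernel j) (sweep c p) :=
      hd.smul ((continuous_reflectL2 _).comp hc.continuous_sweep)
    refine (tendsto_riemannSum hr hG).congr fun N => ?_
    refine Eq.trans ?_ (map_riemannSum
      (SchwartzMap.toLpCLM ℝ ℝ 2 (volume : Measure Plane)).toLinearMap _ _ N).symm
    simp [reflectL2]
  have hae : ∀ N, (fun ω => W.sample ω (ψ N)) =ᵐ[P] W.toL2 ((ψ N).toLp 2 volume) :=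
    fun N => W.sample_ae (ψ N)
  have hmeas : ∀ N, AEStronglyMeasurable (fun ω => W.sample ω (ψ N)) P := fun N =>
    (Lp.aestronglyMeasurable _).congr (hae N).symm
  have hle : eLpNorm (W.increment ρ c j s t) q P ≤
      Module.finrank ℝ (su n) * eLpNorm id q (gaussianReal 0 1) *
        ‖sweepKernel (ρ.lowPassKernel j) c s t‖ₑ := by
    set D : ℝ≥0∞ := Module.finrank ℝ (su n) * eLpNorm id q (gaussianReal 0 1) with hD
    have hDt : D ≠ ∞ := ENNReal.mul_ne_top (by simp) (memLp_id_gaussianReal' q hq').2.ne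
    refine (Lp.eLpNorm_lim_le_liminf_eLpNorm hmeas _ (Filter.Eventually.of_forall hlim)).trans ?_
    have hb : ∀ N, eLpNorm (fun ω => W.sample ω (ψ N)) q P ≤ D * ‖(ψ N).toLp 2 volume‖ₑ :=
      fun N => (eLpNorm_congr_ae (hae N)).trans_le (W.eLpNorm_toL2_le _ hq)
    have hconv : Filter.Tendsto (fun N => D * ‖(ψ N).toLp 2 volume‖ₑ) Filter.atTop
        (nhds (D * ‖sweepKernel (ρ.lowPassKernel j) c s t‖ₑ)) :=
      ENNReal.Tendsto.const_mul hlim2.enorm (Or.inr hDt)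
    exact (Filter.liminf_le_liminf (Filter.Eventually.of_forall hb)).trans hconv.liminf_eq.le
  refine ⟨⟨aestronglyMeasurable_of_tendsto_ae _ hmeas
    (Filter.Eventually.of_forall hlim), hle.trans_lt ?_⟩, hle⟩
  exact ENNReal.mul_lt_top (ENNReal.mul_lt_top (by simp)
    (memLp_id_gaussianReal' q hq').2) (by simp)

end WhiteNoise

end YangMillsPlane

theorem proposition8p5 (n : ℕ) (ρ : YangMillsPlane.LPBump) (c : ℝ → YangMillsPlane.Plane)
    (hc : c ∈ YangMillsPlane.curvesRot) (q : ℝ) (hq : 1 ≤ q) :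
    ∃ C : ℝ, 0 < C ∧
      ∀ (Ω : Type*) [MeasurableSpace Ω] (P : Measure Ω) [IsProbabilityMeasure P]
        (W : YangMillsPlane.WhiteNoise n P) (j : ℤ), -1 ≤ j →
        ∀ s t : ℝ, 0 ≤ s → s < t → t ≤ 1 →
          ∀ σ : ℝ, 0 < σ → σ ≤ 1 / 2 →
            MemLp (W.increment ρ c j s t) (ENNReal.ofReal q) P ∧
            eLpNorm (W.increment ρ c j s t) (ENNReal.ofReal q) P
              ≤ ENNReal.ofReal (C * (t - s) ^ (1 / 2 - σ)) := by
  obtain ⟨A, hA0, hA⟩ := YangMillsPlane.exists_norm_curveOp_sq_le hc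
  obtain ⟨B, hB0, hB⟩ := ρ.exists_lintegral_lowPassKernel_le
  set G : ℝ≥0∞ := Module.finrank ℝ (YangMillsPlane.su n) *
    eLpNorm id (ENNReal.ofReal q) (gaussianReal 0 1) with hG
  have hq1 : 1 ≤ ENNReal.ofReal q := ENNReal.one_le_ofReal.2 hq
  have hGt : G ≠ ∞ :=
    ENNReal.mul_ne_top (by simp) (memLp_id_gaussianReal' _ ENNReal.ofReal_ne_top).2.ne
  -- the summand `1` makes the constant positive also in the degenerate cases
  refine ⟨G.toReal * (B * √A) + 1, by positivity, ?_⟩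
  intro Ω _ P _ W j hj s t hs hst ht σ hσ hσ'
  obtain ⟨h1, h2⟩ := W.memLp_increment ρ hc.1 j hs hst.le ht hq1 ENNReal.ofReal_ne_top
  refine ⟨h1, h2.trans ?_⟩
  have hts : 0 < t - s := sub_pos.2 hst
  have h3 : ‖YangMillsPlane.sweepKernel (ρ.lowPassKernel j) c s t‖ ≤ B * √A * √(t - s) := by
    refine (hc.1.norm_sweepKernel_le hs hst.le ht hB0 (hB j hj)).trans ?_
    rw [mul_assoc, ← Real.sqrt_mul hA0]
    exact mul_le_mul_of_nonneg_left (Real.le_sqrt_of_sq_le (hA s t hs hst.le ht)) hB0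
  have h4 : √(t - s) ≤ (t - s) ^ (1 / 2 - σ) := by
    rw [Real.sqrt_eq_rpow]
    exact Real.rpow_le_rpow_of_exponent_ge hts (by linarith) (by linarith)
  refine le_trans (le_of_eq ?_) (ENNReal.ofReal_le_ofReal (p := G.toReal *
    ‖YangMillsPlane.sweepKernel (ρ.lowPassKernel j) c s t‖) ?_)
  · rw [ENNReal.ofReal_mul ENNReal.toReal_nonneg, ENNReal.ofReal_toReal hGt, ofReal_norm]
  calc G.toReal * ‖YangMillsPlane.sweepKernel (ρ.lowPassKernel j) c s t‖
      ≤ G.toReal * (B * √A * √(t - s)) := by gcongr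
    _ = G.toReal * (B * √A) * √(t - s) := by ring
    _ ≤ (G.toReal * (B * √A) + 1) * (t - s) ^ (1 / 2 - σ) := by
        gcongr
        linarith
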